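/- Let $\mathcal H,\mathcal K$ be finite-dimensional Hilbert spaces, let $\Phi:\mathcal B(\mathcal H)\to\mathcal B(\mathcal K)$ be a quantum channel (a completely positive trace-preserving linear map) with adjoint $\Phi^\dagger$ for the Hilbert–Schmidt inner product $\langle X,Y\rangle=\operatorname{tr}(X^*Y)$, let $\rho\in\mathcal B(\mathcal H)$ be a faithful state (positive definite, $\operatorname{tr}\rho=1$), let $A\in\mathcal B(\mathcal H)$ be any operator and let $t\in\mathbb R$. Real and complex powers of a positive semidefinite operator are taken on its support and are zero on its kernel (this matters only for $\Phi(\rho)$, which need not be invertible). Let $\|X\|_1=\operatorname{tr}|X|$ be the trace norm, let $$\mathcal R^t_{\rho,\Phi}(Y)=\rho^{\frac12-it}\,\Phi^\dagger\!\left(\Phi(\rho)^{-\frac12+it}\,Y\,\Phi(\rho)^{-\frac12-it}\right)\rho^{\frac12+it}$$ be the rotated Petz map, and for $\sigma=\rho,\ B=A$ and for $\sigma=\Phi(\rho),\ B=\Phi(A)$ let $$\gamma^{\mathrm{BKM}}_{\sigma}(B)=\int_0^\infty\operatorname{tr}\!\left(B^*(\sigma+s1)^{-1}B(\sigma+s1)^{-1}\right)ds$$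 be the Bogoliubov–Kubo–Mori metric (both integrals converge). Then $$\gamma^{\mathrm{BKM}}_{\rho}(A)-\gamma^{\mathrm{BKM}}_{\Phi(\rho)}(\Phi(A))\ \ge\ \sup_{0<\epsilon<\frac12}\left(\frac{\pi}{\cosh(\pi t)}\,\frac{\|A-\mathcal R^t_{\rho,\Phi}(\Phi(A))\|_1}{K(\rho,A,\epsilon)}\right)^{\frac{4}{1-2\epsilon}},$$ where the supremum is finite and $$K(\rho,A,\epsilon)=4\operatorname{tr}(A^*\rho^{-1}A)^{\frac12}+2\operatorname{tr}(\rho^{-2}A^*\rho A)^{\frac12}+2\operatorname{tr}\!\left(\Phi(\rho)^{-2}\Phi(A)^*\Phi(\rho)\Phi(A)\right)^{\frac12}+1+(\epsilon e)^{-\frac12}.$$ -/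

import Mathlib

open scoped Matrix ComplexOrder

namespace QInfo

variable {n m : Type*} [Fintype n] [DecidableEq n] [Fintype m] [DecidableEq m]

/-- The ampliation `id_k ⊗ Φ` of a linear map `Φ : M_n(ℂ) → M_m(ℂ)`: it applies `Φ` to each of the
`k × k` blocks of a block matrix. -/
def ampliation (Φ : Matrix n n ℂ →ₗ[ℂ] Matrix m m ℂ) (k : ℕ)
    (X : Matrix (Fin k × n) (Fin k × n) ℂ) : Matrix (Fin k × m) (Fin k × m) ℂ :=
  Matrix.of fun p q =>
    Φ (Matrix.of fun i j => X (p.1, i) (q.1, j)) p.2 q.2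

/-- Quantum channels: completely positive, trace preserving linear maps. -/
structure IsQuantumChannel (Φ : Matrix n n ℂ →ₗ[ℂ] Matrix m m ℂ) : Prop where
  completelyPositive : ∀ (k : ℕ) (X : Matrix (Fin k × n) (Fin k × n) ℂ),
    X.PosSemidef → (ampliation Φ k X).PosSemidef
  tracePreserving : ∀ X : Matrix n n ℂ, (Φ X).trace = X.trace

/-- The adjoint `Φ†` with respect to the Hilbert–Schmidt inner product `⟨X, Y⟩ = tr (X* Y)`,
given by its matrix entries; see `trace_hsAdjoint` for the defining property. -/
noncomputable def hsAdjoint (Φ : Matrix n n ℂ →ₗ[ℂ] Matrix m m ℂ) (Y : Matrix m m ℂ) :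
    Matrix n n ℂ :=
  Matrix.of fun i j => star ((Yᴴ * Φ (Matrix.single i j 1)).trace)

theorem trace_hsAdjoint {n m : Type*} [Fintype n] [DecidableEq n] [Fintype m]
    (Φ : Matrix n n ℂ →ₗ[ℂ] Matrix m m ℂ) (Y : Matrix m m ℂ) (X : Matrix n n ℂ) :
    ((hsAdjoint Φ Y)ᴴ * X).trace = (Yᴴ * Φ X).trace := by
  conv_rhs => rw [Matrix.matrix_eq_sum_single X]
  have h : ∀ i j, Matrix.single i j (X i j) = X i j • (Matrix.single i j 1 : Matrix n n ℂ) := by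
    intro i j; simp [Matrix.smul_single]
  simp only [h, map_sum, map_smul, Matrix.mul_sum, Matrix.mul_smul, Matrix.trace_sum,
    Matrix.trace_smul, smul_eq_mul]
  rw [Matrix.trace, Finset.sum_comm]
  simp only [Matrix.diag_apply, Matrix.mul_apply, Matrix.conjTranspose_apply, hsAdjoint,
    Matrix.of_apply, star_star]
  simp only [mul_comm]

/-- Functional calculus `f(M) = ∑ᵢ f(λᵢ) |φᵢ⟩⟨φᵢ|` of a Hermitian matrix
`M = ∑ᵢ λᵢ |φᵢ⟩⟨φᵢ|`, for complex valued `f` (only used for Hermitian `M`). -/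
noncomputable def hermFun (f : ℝ → ℂ) (M : Matrix n n ℂ) : Matrix n n ℂ :=
  open Classical in
  if h : M.IsHermitian then
    (h.eigenvectorUnitary : Matrix n n ℂ) * Matrix.diagonal (fun i => f (h.eigenvalues i)) *
      (h.eigenvectorUnitary : Matrix n n ℂ)ᴴ
  else 0

/-- The complex power `M ^ z` of a positive semidefinite matrix, taken on the support of `M`
(and zero on the kernel); for invertible `M` this is the ordinary power, for `z = -1` the
(generalized) inverse. -/
noncomputable def suppPow (M : Matrix n n ℂ) (z : ℂ) : Matrix n n ℂ :=
  hermFun (fun x => if 0 < x then (x : ℂ) ^ z else 0) M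

/-- The absolute value `|X| = (X* X)^{1/2}`. -/
noncomputable def matAbs (X : Matrix n n ℂ) : Matrix n n ℂ :=
  hermFun (fun x => (Real.sqrt x : ℂ)) (Xᴴ * X)

/-- The trace norm `‖X‖₁ = tr |X|`. -/
noncomputable def traceNorm (X : Matrix n n ℂ) : ℝ := (matAbs X).trace.re

/-- The rotated Petz map
`ℛ^t_{ρ,Φ}(Y) = ρ^{1/2-it} Φ†(Φ(ρ)^{-1/2+it} Y Φ(ρ)^{-1/2-it}) ρ^{1/2+it}`. -/
noncomputable def rotatedPetz (Φ : Matrix n n ℂ →ₗ[ℂ] Matrix m m ℂ) (ρ : Matrix n n ℂ) (t : ℝ)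
    (Y : Matrix m m ℂ) : Matrix n n ℂ :=
  suppPow ρ (1 / 2 - Complex.I * t) *
    hsAdjoint Φ (suppPow (Φ ρ) (-(1 / 2) + Complex.I * t) * Y *
      suppPow (Φ ρ) (-(1 / 2) - Complex.I * t)) *
    suppPow ρ (1 / 2 + Complex.I * t)

/-- The integrand `tr (A* (ρ+s)⁻¹ A (ρ+s)⁻¹)` of the BKM metric. It is a nonnegative real number
for `ρ ≥ 0` and `s > 0`, hence the real part. -/
noncomputable def bkmIntegrand (ρ A : Matrix n n ℂ) (s : ℝ) : ℝ :=
  (Aᴴ * (ρ + (s : ℂ) • (1 : Matrix n n ℂ))⁻¹ * A *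
    (ρ + (s : ℂ) • (1 : Matrix n n ℂ))⁻¹).trace.re

/-- The Bogoliubov–Kubo–Mori metric
`γ_ρ(A) = ∫₀^∞ tr (A* (ρ+s)⁻¹ A (ρ+s)⁻¹) ds`. -/
noncomputable def bkmMetric (ρ A : Matrix n n ℂ) : ℝ :=
  ∫ s in Set.Ioi (0 : ℝ), bkmIntegrand ρ A s

/-- The constant
`K(ρ,A,ε) = 4 tr(A* ρ⁻¹ A)^{1/2} + 2 tr(ρ⁻² A* ρ A)^{1/2}
  + 2 tr(Φ(ρ)⁻² Φ(A)* Φ(ρ) Φ(A))^{1/2} + 1 + (ε e)^{-1/2}`. -/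
noncomputable def bkmConst (Φ : Matrix n n ℂ →ₗ[ℂ] Matrix m m ℂ) (ρ A : Matrix n n ℂ) (ε : ℝ) :
    ℝ :=
  4 * Real.sqrt (Aᴴ * suppPow ρ (-1) * A).trace.re
    + 2 * Real.sqrt (suppPow ρ (-2) * Aᴴ * ρ * A).trace.re
    + 2 * Real.sqrt (suppPow (Φ ρ) (-2) * (Φ A)ᴴ * Φ ρ * Φ A).trace.re
    + 1 + (ε * Real.exp 1) ^ (-(1 / 2) : ℝ)

/-- The lower bound
`((π / cosh(πt)) ‖A - ℛ^t_{ρ,Φ}(Φ(A))‖₁ / K(ρ,A,ε)) ^ (4/(1-2ε))` for a fixed `ε`. -/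
noncomputable def bkmLowerBound (Φ : Matrix n n ℂ →ₗ[ℂ] Matrix m m ℂ) (ρ A : Matrix n n ℂ)
    (t ε : ℝ) : ℝ :=
  (Real.pi / Real.cosh (Real.pi * t) *
    (traceNorm (A - rotatedPetz Φ ρ t (Φ A)) / bkmConst Φ ρ A ε)) ^ (4 / (1 - 2 * ε))

end QInfo

/-! Write `σ = Φ(ρ)` and `B = Φ(A)`, let `T_s` solve `T ρ + s ρ T = A`, let `S_s` solve `S σ + s σ S
= B`, and put `E_s = T_s - Φ†(S_s)`. Rescaling the integration variable turns the BKM metric of `A`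
into the integral of `tr(A* T_s)` against `ds / (1 + s)`, and likewise for `B`
(`bkmMetric_eq_integral`). So the defect `D` of the two metrics is the integral of `d(s) / (1 + s)`
with `d(s) = tr(A* T_s) - tr(B* S_s)`. Completing a square and using the Schwarz inequality for `Φ†`
gives `s tr(E_s* ρ E_s) ≤ d(s)` (`IsQuantumChannel.weightedSq_sub_le`).

The rotated Petz map enters through a Mellin transform: the integral of `s^(z-1) / (y + s x)` is `π
/ sin(πz) * x^(-z) y^(z-1)`. At `z = 1/2 - it` this shows that the integral of `s^(-1/2-it) E_s` is
`π / cosh(πt)` times `Z`, the `recoveryError` (`mellin_lyapunovSolution`). Hölder's inequality and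
`tr ρ = 1` bound the trace norm of `A - ℛ^t(Φ(A))` by `tr(Z* ρ Z)^(1/2)`.

It remains to bound the integral of `s^(-1/2) tr(E_s* ρ E_s)^(1/2)` by a power of `D`.
Cauchy–Schwarz against `d(s) / (1 + s)` leaves the weight `(1 + s) / s^2`, which is not integrable
at either end, so it is applied only on `[a, 1/a]`; the two tails are controlled by a priori bounds
and contribute the traces in `K` (`integral_inv_sqrt_mul_le`). The choice `a = √D` gives the
exponent, and `ε` is spent on absorbing a logarithm (`le_mul_rpow_of_forall_le`). -/

namespace QInfo

/-- The quadratic form `tr (X* M X)`. -/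
noncomputable def weightedSq {n : Type*} [Fintype n] (M X : Matrix n n ℂ) : ℝ :=
  (Xᴴ * M * X).trace.re

theorem weightedSq_nonneg {n : Type*} [Fintype n] {M : Matrix n n ℂ} (hM : M.PosSemidef)
    (X : Matrix n n ℂ) :
    0 ≤ weightedSq M X := by
  have := (hM.conjTranspose_mul_mul_same X).trace_nonneg
  exact (Complex.le_def.1 this).1

/-! ### Functional calculus and Schur multipliers in an eigenbasis. -/

section Spectral

variable {n : Type*} [Fintype n] [DecidableEq n]

/-- The matrix of `A` in an eigenbasis of the Hermitian matrix `M`. -/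
noncomputable def eigenConj {M : Matrix n n ℂ} (hM : M.IsHermitian) (A : Matrix n n ℂ) :
    Matrix n n ℂ :=
  (hM.eigenvectorUnitary : Matrix n n ℂ)ᴴ * A * (hM.eigenvectorUnitary : Matrix n n ℂ)

/-- The double operator integral: the Schur multiplier `g (λᵢ, λⱼ)` in an eigenbasis of `M`. -/
noncomputable def schurFun {M : Matrix n n ℂ} (hM : M.IsHermitian) (g : ℝ → ℝ → ℂ)
    (A : Matrix n n ℂ) : Matrix n n ℂ :=
  (hM.eigenvectorUnitary : Matrix n n ℂ) *
    Matrix.of (fun i j => g (hM.eigenvalues i) (hM.eigenvalues j) * eigenConj hM A i j) *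
    (hM.eigenvectorUnitary : Matrix n n ℂ)ᴴ

variable {M : Matrix n n ℂ} (hM : M.IsHermitian)

theorem eigenvectorUnitary_conjTranspose_mul :
    (hM.eigenvectorUnitary : Matrix n n ℂ)ᴴ * (hM.eigenvectorUnitary : Matrix n n ℂ) = 1 :=
  Unitary.coe_star_mul_self hM.eigenvectorUnitary

theorem eigenvectorUnitary_mul_conjTranspose :
    (hM.eigenvectorUnitary : Matrix n n ℂ) * (hM.eigenvectorUnitary : Matrix n n ℂ)ᴴ = 1 :=
  Unitary.coe_mul_star_self hM.eigenvectorUnitary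

theorem eigenConj_mul (A B : Matrix n n ℂ) :
    eigenConj hM (A * B) = eigenConj hM A * eigenConj hM B := by
  have h := eigenvectorUnitary_mul_conjTranspose hM
  unfold eigenConj
  set U := (hM.eigenvectorUnitary : Matrix n n ℂ)
  calc Uᴴ * (A * B) * U = Uᴴ * A * 1 * B * U := by simp only [Matrix.mul_assoc, Matrix.one_mul]
    _ = _ := by rw [← h]; simp only [Matrix.mul_assoc]

theorem eigenConj_conjTranspose (A : Matrix n n ℂ) :
    eigenConj hM Aᴴ = (eigenConj hM A)ᴴ := by
  simp [eigenConj, Matrix.conjTranspose_mul, Matrix.mul_assoc]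

theorem trace_eigenConj (A : Matrix n n ℂ) : (eigenConj hM A).trace = A.trace := by
  rw [eigenConj, Matrix.trace_mul_cycle, eigenvectorUnitary_mul_conjTranspose, Matrix.one_mul]

theorem eigenConj_injective {A B : Matrix n n ℂ} (h : eigenConj hM A = eigenConj hM B) :
    A = B := by
  have key : ∀ X : Matrix n n ℂ, (hM.eigenvectorUnitary : Matrix n n ℂ) * eigenConj hM X *
      (hM.eigenvectorUnitary : Matrix n n ℂ)ᴴ = X := by
    intro X
    rw [eigenConj, ← Matrix.mul_assoc, ← Matrix.mul_assoc, Matrix.mul_assoc,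
      eigenvectorUnitary_mul_conjTranspose, Matrix.one_mul, Matrix.mul_one]
  rw [← key A, h, key]

theorem eigenConj_schurFun (g : ℝ → ℝ → ℂ) (A : Matrix n n ℂ) :
    eigenConj hM (schurFun hM g A) =
      Matrix.of fun i j => g (hM.eigenvalues i) (hM.eigenvalues j) * eigenConj hM A i j := by
  rw [schurFun]
  conv_lhs => rw [eigenConj]
  rw [← Matrix.mul_assoc, ← Matrix.mul_assoc, Matrix.mul_assoc,
      eigenvectorUnitary_conjTranspose_mul, Matrix.one_mul, Matrix.mul_one]

theorem eigenConj_hermFun (f : ℝ → ℂ) :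
    eigenConj hM (hermFun f M) = Matrix.diagonal fun i => f (hM.eigenvalues i) := by
  rw [hermFun, dif_pos hM, eigenConj, ← Matrix.mul_assoc, ← Matrix.mul_assoc, Matrix.mul_assoc,
      eigenvectorUnitary_conjTranspose_mul, Matrix.one_mul, Matrix.mul_one]

theorem eigenConj_self :
    eigenConj hM M = Matrix.diagonal fun i => (hM.eigenvalues i : ℂ) :=
  (Unitary.conjStarAlgAut_star_apply hM.eigenvectorUnitary M).symm.trans
    hM.conjStarAlgAut_star_eigenvectorUnitary

theorem hermFun_ofReal (hM : M.IsHermitian) : hermFun (fun x => (x : ℂ)) M = M := by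
  apply eigenConj_injective hM
  rw [eigenConj_hermFun, eigenConj_self]

theorem hermFun_congr {f g : ℝ → ℂ}
    (h : ∀ i, f (hM.eigenvalues i) = g (hM.eigenvalues i)) : hermFun f M = hermFun g M := by
  apply eigenConj_injective hM
  rw [eigenConj_hermFun, eigenConj_hermFun]
  simp only [h]

theorem hermFun_mul_hermFun (hM : M.IsHermitian) (f g : ℝ → ℂ) :
    hermFun f M * hermFun g M = hermFun (fun x => f x * g x) M := by
  apply eigenConj_injective hM
  rw [eigenConj_mul]
  simp only [eigenConj_hermFun, Matrix.diagonal_mul_diagonal]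

theorem conjTranspose_hermFun (hM : M.IsHermitian) (f : ℝ → ℂ) :
    (hermFun f M)ᴴ = hermFun (fun x => star (f x)) M := by
  apply eigenConj_injective hM
  rw [eigenConj_conjTranspose]
  simp only [eigenConj_hermFun, Matrix.diagonal_conjTranspose]
  rfl

theorem trace_hermFun (f : ℝ → ℂ) : (hermFun f M).trace = ∑ i, f (hM.eigenvalues i) := by
  rw [← trace_eigenConj hM, eigenConj_hermFun, Matrix.trace_diagonal]

theorem hermFun_mul_mul_hermFun (f g : ℝ → ℂ) (A : Matrix n n ℂ) :
    hermFun f M * A * hermFun g M = schurFun hM (fun x y => f x * g y) A := by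
  apply eigenConj_injective hM
  rw [eigenConj_mul, eigenConj_mul, eigenConj_schurFun, eigenConj_hermFun, eigenConj_hermFun]
  ext i j
  simp [Matrix.mul_diagonal, Matrix.diagonal_mul]
  ring

theorem mul_schurFun (g : ℝ → ℝ → ℂ) (A : Matrix n n ℂ) :
    M * schurFun hM g A = schurFun hM (fun x y => x * g x y) A := by
  apply eigenConj_injective hM
  rw [eigenConj_mul, eigenConj_schurFun, eigenConj_schurFun, eigenConj_self]
  ext i j
  simp [Matrix.diagonal_mul, mul_assoc]

theorem schurFun_mul (g : ℝ → ℝ → ℂ) (A : Matrix n n ℂ) :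
    schurFun hM g A * M = schurFun hM (fun x y => g x y * y) A := by
  apply eigenConj_injective hM
  rw [eigenConj_mul, eigenConj_schurFun, eigenConj_schurFun, eigenConj_self]
  ext i j
  simp [Matrix.mul_diagonal]
  ring

theorem trace_conjTranspose_mul_schurFun (g : ℝ → ℝ → ℂ) (A B : Matrix n n ℂ) :
    (Aᴴ * schurFun hM g B).trace = ∑ i, ∑ j, g (hM.eigenvalues i) (hM.eigenvalues j) *
      (star (eigenConj hM A i j) * eigenConj hM B i j) := by
  rw [← trace_eigenConj hM, eigenConj_mul, eigenConj_schurFun, eigenConj_conjTranspose,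
    Matrix.trace, Finset.sum_comm]
  simp only [Matrix.diag_apply, Matrix.mul_apply, Matrix.conjTranspose_apply, Matrix.of_apply]
  refine Finset.sum_congr rfl fun i _ => Finset.sum_congr rfl fun j _ => ?_
  ring

theorem re_trace_conjTranspose_mul_schurFun (g : ℝ → ℝ → ℝ) (A : Matrix n n ℂ) :
    (Aᴴ * schurFun hM (fun x y => (g x y : ℂ)) A).trace.re =
      ∑ i, ∑ j, g (hM.eigenvalues i) (hM.eigenvalues j) * ‖eigenConj hM A i j‖ ^ 2 := by
  rw [trace_conjTranspose_mul_schurFun]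
  simp only [Complex.re_sum]
  refine Finset.sum_congr rfl fun i _ => Finset.sum_congr rfl fun j _ => ?_
  rw [Complex.star_def, Complex.conj_mul']
  norm_cast

/-- `A` lives on the support of `M` from both sides. -/
def IsSupported (A : Matrix n n ℂ) : Prop :=
  ∀ i j, eigenConj hM A i j ≠ 0 → 0 < hM.eigenvalues i ∧ 0 < hM.eigenvalues j

theorem weightedSq_schurFun (g : ℝ → ℝ → ℝ) (A : Matrix n n ℂ) :
    weightedSq M (schurFun hM (fun x y => (g x y : ℂ)) A) =
      ∑ i, ∑ j, hM.eigenvalues i * g (hM.eigenvalues i) (hM.eigenvalues j) ^ 2 *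
        ‖eigenConj hM A i j‖ ^ 2 := by
  rw [weightedSq, Matrix.mul_assoc, mul_schurFun, trace_conjTranspose_mul_schurFun]
  simp only [Complex.re_sum, eigenConj_schurFun, Matrix.of_apply]
  refine Finset.sum_congr rfl fun i _ => Finset.sum_congr rfl fun j _ => ?_
  have h := Complex.conj_mul' (eigenConj hM A i j)
  rw [star_mul', Complex.star_def, Complex.conj_ofReal]
  rw [show ∀ (x g a b : ℂ), x * g * (g * a * b) = x * g ^ 2 * (a * b) by intros; ring, h]
  norm_cast

end Spectral

/-! ### Cauchy–Schwarz inequalities for trace pairings. -/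

theorem norm_trace_conjTranspose_mul_le {n m : Type*} [Fintype n] [Fintype m]
    (X Y : Matrix n m ℂ) :
    ‖(Xᴴ * Y).trace‖ ≤ √(Xᴴ * X).trace.re * √(Yᴴ * Y).trace.re := by
  let f : Matrix n m ℂ → EuclideanSpace ℂ (n × m) := fun X => WithLp.toLp 2 fun p => X p.1 p.2
  have h : ∀ X Y : Matrix n m ℂ, inner ℂ (f X) (f Y) = (Xᴴ * Y).trace := by
    intro X Y
    simp only [PiLp.inner_apply, f, Matrix.trace, Matrix.diag_apply, Matrix.mul_apply,
      Matrix.conjTranspose_apply, Fintype.sum_prod_type]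
    rw [Finset.sum_comm]
    refine Finset.sum_congr rfl fun i _ => Finset.sum_congr rfl fun j _ => ?_
    simp [mul_comm]
  have h2 : ∀ X : Matrix n m ℂ, ‖f X‖ = √(Xᴴ * X).trace.re := by
    intro X
    rw [← h, norm_eq_sqrt_re_inner (𝕜 := ℂ)]
    rfl
  rw [← h, ← h2, ← h2]
  exact norm_inner_le_norm _ _

section Spectral

variable {n : Type*} [Fintype n] [DecidableEq n]

theorem hermFun_sqrt_mul_self {M : Matrix n n ℂ} (hM : M.PosSemidef) :
    hermFun (fun x => (√x : ℂ)) M * hermFun (fun x => (√x : ℂ)) M = M := by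
  rw [hermFun_mul_hermFun hM.1]
  nth_rewrite 2 [← hermFun_ofReal hM.1]
  refine hermFun_congr hM.1 fun i => ?_
  rw [← Complex.ofReal_mul, Real.mul_self_sqrt (hM.eigenvalues_nonneg i)]

theorem conjTranspose_hermFun_sqrt {M : Matrix n n ℂ} (hM : M.IsHermitian) :
    (hermFun (fun x => (√x : ℂ)) M)ᴴ = hermFun (fun x => (√x : ℂ)) M := by
  rw [conjTranspose_hermFun hM]
  simp

theorem norm_trace_weighted_le {M : Matrix n n ℂ} (hM : M.PosSemidef) (X Y : Matrix n n ℂ) :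
    ‖(Xᴴ * M * Y).trace‖ ≤ √(weightedSq M X) * √(weightedSq M Y) := by
  have key : ∀ X Y : Matrix n n ℂ, Xᴴ * M * Y =
      (hermFun (fun x => (√x : ℂ)) M * X)ᴴ * (hermFun (fun x => (√x : ℂ)) M * Y) := by
    intro X Y
    rw [Matrix.conjTranspose_mul, conjTranspose_hermFun_sqrt hM.1]
    nth_rewrite 1 [← hermFun_sqrt_mul_self hM]
    simp only [Matrix.mul_assoc]
  unfold weightedSq
  rw [key, key, key]
  exact norm_trace_conjTranspose_mul_le _ _

end Spectral

/-! ### Channels, their adjoints and the Schwarz inequality. -/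

theorem re_trace_conjTranspose {n : Type*} [Fintype n] (X : Matrix n n ℂ) :
    (Xᴴ).trace.re = X.trace.re := by
  rw [Matrix.trace_conjTranspose, Complex.star_def, Complex.conj_re]

theorem trace_conjTranspose_mul_hsAdjoint {n m : Type*} [Fintype n] [DecidableEq n] [Fintype m]
    (Φ : Matrix n n ℂ →ₗ[ℂ] Matrix m m ℂ) (S : Matrix m m ℂ) (X : Matrix n n ℂ) :
    (Xᴴ * hsAdjoint Φ S).trace = ((Φ X)ᴴ * S).trace := by
  have h := congrArg star (trace_hsAdjoint Φ S X)
  rw [← Matrix.trace_conjTranspose, ← Matrix.trace_conjTranspose, Matrix.conjTranspose_mul,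
    Matrix.conjTranspose_mul] at h
  simpa using h

theorem re_trace_mul_lyapunov {n : Type*} [Fintype n] (s : ℝ) (M E : Matrix n n ℂ) :
    (Eᴴ * (E * M + (s : ℂ) • (M * E))).trace.re =
      (E * M * Eᴴ).trace.re + s * weightedSq M E := by
  rw [Matrix.mul_add, Matrix.mul_smul, Matrix.trace_add, Matrix.trace_smul, weightedSq,
    Matrix.trace_mul_comm Eᴴ, ← Matrix.mul_assoc]
  simp

/-- Stacking the `W a` into one column `W`, this is the ampliation of `Φ` applied to the positive
matrix `W ρ W*`. -/
theorem IsQuantumChannel.posSemidef_blocks {n m : Type*} [Fintype n] [Fintype m]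
    {Φ : Matrix n n ℂ →ₗ[ℂ] Matrix m m ℂ} {ρ : Matrix n n ℂ} (hΦ : IsQuantumChannel Φ)
    (hρ : ρ.PosSemidef) {k : ℕ} (W : Fin k → Matrix n n ℂ) :
    (Matrix.of fun p q : Fin k × m => Φ (W p.1 * ρ * (W q.1)ᴴ) p.2 q.2).PosSemidef := by
  have h := hΦ.completelyPositive k _ (hρ.mul_mul_conjTranspose_same
    (Matrix.of fun (p : Fin k × n) (j : n) => W p.1 p.2 j))
  exact h

section Channel

variable {n m : Type*} [Fintype n] [Fintype m]
  {Φ : Matrix n n ℂ →ₗ[ℂ] Matrix m m ℂ} {ρ : Matrix n n ℂ}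

theorem IsQuantumChannel.sum_trace_blocks_nonneg (hΦ : IsQuantumChannel Φ) (hρ : ρ.PosSemidef)
    {k : ℕ} (W : Fin k → Matrix n n ℂ) (V : Fin k → Matrix m m ℂ) :
    0 ≤ (∑ a, ∑ b, ((V a)ᴴ * Φ (W a * ρ * (W b)ᴴ) * V b).trace).re := by
  have h := ((hΦ.posSemidef_blocks hρ W).conjTranspose_mul_mul_same
    (Matrix.of fun (p : Fin k × m) (j : m) => V p.1 p.2 j)).trace_nonneg
  refine (Complex.le_def.1 h).1.trans_eq (congrArg Complex.re ?_)
  simp only [Matrix.trace, Matrix.diag_apply, Matrix.mul_apply, Matrix.conjTranspose_apply,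
    Matrix.of_apply, Fintype.sum_prod_type, Finset.sum_mul]
  rw [Finset.sum_comm]
  conv_rhs => rw [Finset.sum_comm]
  refine Finset.sum_congr rfl fun b _ => ?_
  conv_rhs => rw [Finset.sum_comm]
  exact Finset.sum_congr rfl fun x _ => Finset.sum_comm

variable [DecidableEq n]

theorem IsQuantumChannel.map_posSemidef (hΦ : IsQuantumChannel Φ) (hρ : ρ.PosSemidef) :
    (Φ ρ).PosSemidef := by
  have h := (hΦ.posSemidef_blocks hρ (k := 1) fun _ => 1).submatrix fun i : m => ((0 : Fin 1), i)
  have hW : (Matrix.of fun p q : Fin 1 × m => Φ (1 * ρ * (1 : Matrix n n ℂ)ᴴ) p.2 q.2).submatrix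
      (fun i : m => ((0 : Fin 1), i)) (fun i : m => ((0 : Fin 1), i)) = Φ ρ := by
    ext i j; simp
  exact hW ▸ h

theorem IsQuantumChannel.map_conjTranspose (hΦ : IsQuantumChannel Φ) (X : Matrix n n ℂ) :
    Φ Xᴴ = (Φ X)ᴴ := by
  -- The off-diagonal blocks of the positive matrix built from `X` and `1` are `Φ X` and `Φ Xᴴ`;
  -- hermiticity makes them adjoint to each other.
  have h := (hΦ.posSemidef_blocks Matrix.PosSemidef.one ![X, 1]).1
  ext i j
  have := congrFun (congrFun h ((1 : Fin 2), i)) ((0 : Fin 2), j)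
  simpa using this.symm

theorem IsQuantumChannel.hsAdjoint_conjTranspose (hΦ : IsQuantumChannel Φ) (S : Matrix m m ℂ) :
    hsAdjoint Φ Sᴴ = (hsAdjoint Φ S)ᴴ := by
  ext i j
  have h : Φ (Matrix.single j i 1) = (Φ (Matrix.single i j 1))ᴴ := by
    rw [← hΦ.map_conjTranspose]; simp
  simp only [hsAdjoint, Matrix.of_apply, Matrix.conjTranspose_apply, star_star, h,
    Matrix.conjTranspose_conjTranspose]
  rw [← Matrix.conjTranspose_mul, Matrix.trace_conjTranspose, Matrix.trace_mul_comm]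

variable [DecidableEq m]

/-- The Schwarz inequality for the adjoint channel, tested against the state `ρ`. -/
theorem IsQuantumChannel.trace_hsAdjoint_mul_le (hΦ : IsQuantumChannel Φ) (hρ : ρ.PosSemidef)
    (S : Matrix m m ℂ) :
    (hsAdjoint Φ S * ρ * (hsAdjoint Φ S)ᴴ).trace.re ≤ (S * Φ ρ * Sᴴ).trace.re := by
  set Y := hsAdjoint Φ S with hY
  -- With `Y = Φ†(S)` the four block terms are `tr(Y ρ Y*)` once with sign plus, twice with sign
  -- minus in real part, and `tr(S Φ(ρ) S*)`. Trace preservation handles the first.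
  have h := hΦ.sum_trace_blocks_nonneg hρ ![Y, -1] ![1, Sᴴ]
  have h1 : (Φ (Y * ρ) * Sᴴ).trace = (Y * ρ * Yᴴ).trace := by
    rw [Matrix.trace_mul_comm, ← trace_hsAdjoint, Matrix.trace_mul_comm]
  have h2 : (S * Φ (ρ * Yᴴ)).trace.re = (Y * ρ * Yᴴ).trace.re := by
    rw [← h1, ← re_trace_conjTranspose (Φ (Y * ρ) * Sᴴ), Matrix.conjTranspose_mul,
      ← hΦ.map_conjTranspose, Matrix.conjTranspose_mul, hρ.1.eq,
      Matrix.conjTranspose_conjTranspose]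
  simp [Fin.sum_univ_two, h1, h2, hΦ.tracePreserving] at h
  linarith

theorem IsQuantumChannel.weightedSq_hsAdjoint_le (hΦ : IsQuantumChannel Φ) (hρ : ρ.PosSemidef)
    (S : Matrix m m ℂ) : weightedSq ρ (hsAdjoint Φ S) ≤ weightedSq (Φ ρ) S := by
  have h := hΦ.trace_hsAdjoint_mul_le hρ Sᴴ
  rw [hΦ.hsAdjoint_conjTranspose, Matrix.conjTranspose_conjTranspose,
    Matrix.conjTranspose_conjTranspose] at h
  exact h

/-- If `T` and `S` solve `T ρ + s ρ T = A` and `S Φ(ρ) + s Φ(ρ) S = Φ(A)`, then the defect of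
monotonicity of `A ↦ tr (A* T)` controls the distance of `T` and `Φ†(S)`. -/
theorem IsQuantumChannel.weightedSq_sub_le (hΦ : IsQuantumChannel Φ) (hρ : ρ.PosSemidef)
    {s : ℝ} (hs : 0 ≤ s) {A T : Matrix n n ℂ} {S : Matrix m m ℂ}
    (hT : T * ρ + (s : ℂ) • (ρ * T) = A) (hS : S * Φ ρ + (s : ℂ) • (Φ ρ * S) = Φ A) :
    s * weightedSq ρ (T - hsAdjoint Φ S) ≤ (Aᴴ * T).trace.re - ((Φ A)ᴴ * S).trace.re := by
  set Y := hsAdjoint Φ S with hY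
  have hA : ((Φ A)ᴴ * S).trace.re = (Aᴴ * Y).trace.re := by
    rw [hY, trace_conjTranspose_mul_hsAdjoint]
  have hA' : (Yᴴ * A).trace.re = (Aᴴ * Y).trace.re := by
    rw [← re_trace_conjTranspose, Matrix.conjTranspose_mul, Matrix.conjTranspose_conjTranspose]
  have hTA : (Tᴴ * A).trace.re = (Aᴴ * T).trace.re := by
    rw [← re_trace_conjTranspose, Matrix.conjTranspose_mul, Matrix.conjTranspose_conjTranspose]
  have hSB : (Sᴴ * Φ A).trace.re = (Aᴴ * Y).trace.re := by
    rw [← hA', hY, trace_hsAdjoint]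
  -- Let `q(X) = tr(X* (X ρ + s ρ X))`. The equation for `T` gives `Re q(T - Y) = Re q(T) - 2 Re
  -- tr(A* Y) + Re q(Y)`. Here `Re tr(A* Y)` is the corresponding form of `S` for `Φ(ρ)`, and the
  -- Schwarz inequality, on both sides of the weight, bounds `Re q(Y)` by that same number.
  have hE := re_trace_mul_lyapunov s ρ (T - Y)
  have hYY := re_trace_mul_lyapunov s ρ Y
  have hSS := re_trace_mul_lyapunov s (Φ ρ) S
  rw [hS, hSB] at hSS
  have h0 : 0 ≤ ((T - Y) * ρ * (T - Y)ᴴ).trace.re := by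
    have := weightedSq_nonneg hρ (T - Y)ᴴ
    rwa [weightedSq, Matrix.conjTranspose_conjTranspose] at this
  rw [Matrix.conjTranspose_sub] at h0
  have h1 := hΦ.trace_hsAdjoint_mul_le hρ S
  rw [← hY] at h1
  have h2 := mul_le_mul_of_nonneg_left (hΦ.weightedSq_hsAdjoint_le hρ S) hs
  rw [← hY] at h2
  have hlin : (T - Y) * ρ + (s : ℂ) • (ρ * (T - Y)) = A - (Y * ρ + (s : ℂ) • (ρ * Y)) := by
    rw [← hT, Matrix.sub_mul, Matrix.mul_sub, smul_sub]
    abel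
  have hcross : (Tᴴ * (Y * ρ + (s : ℂ) • (ρ * Y))).trace = (Aᴴ * Y).trace := by
    rw [← hT, Matrix.mul_add, Matrix.conjTranspose_add, Matrix.conjTranspose_smul,
      Matrix.conjTranspose_mul, Matrix.conjTranspose_mul, hρ.1.eq, Matrix.add_mul,
      Matrix.trace_add, Matrix.trace_add, ← Matrix.mul_assoc, Matrix.trace_mul_comm (Tᴴ * Y),
      Matrix.mul_assoc ρ]
    simp [Matrix.mul_assoc]
  rw [hlin, Matrix.conjTranspose_sub, Matrix.sub_mul, Matrix.mul_sub, Matrix.mul_sub,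
    Matrix.trace_sub, Matrix.trace_sub, Matrix.trace_sub, hcross] at hE
  simp only [Complex.sub_re] at hE
  linarith

/-- Let `S` be the part of `Φ(A)` in the kernel rows of `Φ(ρ)`. Its weighted norm vanishes, hence so
does that of `Φ†(S)`. Writing `A* = (ρ⁻¹ A)* ρ`, Cauchy–Schwarz gives `tr(A* Φ†(S)) = 0`, and this
trace is the sum of the squared entries of those rows. -/
theorem IsQuantumChannel.eigenConj_map_eq_zero (hΦ : IsQuantumChannel Φ) (hρ : ρ.PosDef)
    (hσ : (Φ ρ).IsHermitian) (A : Matrix n n ℂ) {i : m} (hi : ¬ 0 < hσ.eigenvalues i) (j : m) :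
    eigenConj hσ (Φ A) i j = 0 := by
  have hpsd := hΦ.map_posSemidef hρ.posSemidef
  set g : ℝ → ℝ → ℝ := fun x _ => if 0 < x then 0 else 1 with hg
  set S := schurFun hσ (fun x y => (g x y : ℂ)) (Φ A) with hS
  have h0 : weightedSq (Φ ρ) S = 0 := by
    rw [hS, weightedSq_schurFun]
    refine Finset.sum_eq_zero fun i _ => Finset.sum_eq_zero fun j _ => ?_
    have := hpsd.eigenvalues_nonneg i
    by_cases h : 0 < hσ.eigenvalues i
    · simp [hg, h]
    · have : hσ.eigenvalues i = 0 := le_antisymm (not_lt.1 h) this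
      simp [this]
  have h1 : weightedSq ρ (hsAdjoint Φ S) = 0 :=
    le_antisymm ((hΦ.weightedSq_hsAdjoint_le hρ.posSemidef S).trans_eq h0)
      (weightedSq_nonneg hρ.posSemidef _)
  have h2 := norm_trace_weighted_le hρ.posSemidef (ρ⁻¹ * A) (hsAdjoint Φ S)
  have hinv : ρ⁻¹ * ρ = 1 := Matrix.nonsing_inv_mul _ ((Matrix.isUnit_iff_isUnit_det _).1 hρ.isUnit)
  rw [h1, Real.sqrt_zero, mul_zero, Matrix.conjTranspose_mul, hρ.inv.1.eq, Matrix.mul_assoc Aᴴ,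
    hinv, Matrix.mul_one, trace_conjTranspose_mul_hsAdjoint] at h2
  have h3 : ((Φ A)ᴴ * S).trace.re = 0 := by
    rw [norm_le_zero_iff.1 h2]; rfl
  rw [hS, re_trace_conjTranspose_mul_schurFun] at h3
  have hnn : ∀ i j, 0 ≤ g (hσ.eigenvalues i) (hσ.eigenvalues j) * ‖eigenConj hσ (Φ A) i j‖ ^ 2 := by
    intro i j
    have : 0 ≤ g (hσ.eigenvalues i) (hσ.eigenvalues j) := by
      simp only [hg]; split_ifs <;> norm_num
    positivity
  rw [Finset.sum_eq_zero_iff_of_nonneg fun i _ => Finset.sum_nonneg fun j _ => hnn i j] at h3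
  have h4 := (Finset.sum_eq_zero_iff_of_nonneg fun j _ => hnn i j).1 (h3 i (Finset.mem_univ i)) j
    (Finset.mem_univ j)
  simpa [hg, hi] using h4

theorem IsQuantumChannel.isSupported_map (hΦ : IsQuantumChannel Φ) (hρ : ρ.PosDef)
    (hσ : (Φ ρ).IsHermitian) (A : Matrix n n ℂ) : IsSupported hσ (Φ A) := by
  intro i j hij
  constructor
  · by_contra h
    exact hij (hΦ.eigenConj_map_eq_zero hρ hσ A h j)
  · by_contra h
    have h1 := hΦ.eigenConj_map_eq_zero hρ hσ Aᴴ h i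
    rw [hΦ.map_conjTranspose, eigenConj_conjTranspose, Matrix.conjTranspose_apply,
      star_eq_zero] at h1
    exact hij h1

theorem isSupported_of_posDef (hρ : ρ.PosDef) (A : Matrix n n ℂ) : IsSupported hρ.1 A :=
  fun i j _ => ⟨hρ.eigenvalues_pos i, hρ.eigenvalues_pos j⟩

end Channel

/-! ### Scalar integrals: Mellin transforms and integrability. -/

section ScalarIntegrals

open MeasureTheory Set

theorem image_div_one_add_Ioi : (fun s : ℝ => s / (1 + s)) '' Ioi 0 = Ioo 0 1 := by
  ext u
  simp only [mem_image, mem_Ioi, mem_Ioo]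
  constructor
  · rintro ⟨s, hs, rfl⟩
    exact ⟨by positivity, by rw [div_lt_one (by positivity)]; linarith⟩
  · rintro ⟨h0, h1⟩
    refine ⟨u / (1 - u), div_pos h0 (by linarith), ?_⟩
    have : 1 - u ≠ 0 := by linarith
    field_simp
    ring

theorem injOn_div_one_add_Ioi : InjOn (fun s : ℝ => s / (1 + s)) (Ioi 0) := by
  intro a ha b hb h
  simp only [mem_Ioi] at ha hb
  have h1 : 1 + a ≠ 0 := by linarith
  have h2 : 1 + b ≠ 0 := by linarith
  simp only at h
  field_simp at h
  linarith

theorem hasDerivAt_div_one_add {s : ℝ} (hs : 0 < s) :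
    HasDerivAt (fun s : ℝ => s / (1 + s)) ((1 + s) ^ 2)⁻¹ s := by
  have h1 : 1 + s ≠ 0 := by linarith
  refine ((hasDerivAt_id s).div ((hasDerivAt_id s).const_add 1) h1).congr_deriv ?_
  simp

theorem smul_beta_integrand {z : ℂ} {s : ℝ} (hs : 0 < s) :
    |((1 + s) ^ 2)⁻¹| • (((s / (1 + s) : ℝ) : ℂ) ^ (z - 1) *
      (1 - ((s / (1 + s) : ℝ) : ℂ)) ^ ((1 - z) - 1)) =
    (s : ℂ) ^ (z - 1) • (((1 + s)⁻¹ : ℝ) : ℂ) := by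
  have h1 : (0 : ℝ) < 1 + s := by linarith
  have h1c : ((1 + s : ℝ) : ℂ) ≠ 0 := by exact_mod_cast h1.ne'
  have h2 : (1 - ((s / (1 + s) : ℝ) : ℂ)) = (((1 + s)⁻¹ : ℝ) : ℂ) := by
    rw [← Complex.ofReal_one, ← Complex.ofReal_sub]
    congr 1
    field_simp
    ring
  rw [h2, abs_of_pos (by positivity), div_eq_mul_inv, Complex.ofReal_mul,
    Complex.mul_cpow_ofReal_nonneg hs.le (by positivity), mul_assoc,
    ← Complex.cpow_add _ _ (by simpa using h1c), show z - 1 + (1 - z - 1) = -1 by ring,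
    Complex.cpow_neg_one]
  rw [Complex.real_smul, smul_eq_mul]
  push_cast at h1c ⊢
  field_simp

theorem mellinConvergent_inv_one_add {z : ℂ} (h0 : 0 < z.re) (h1 : z.re < 1) :
    MellinConvergent (fun s : ℝ => (((1 + s)⁻¹ : ℝ) : ℂ)) z := by
  have hb := Complex.betaIntegral_convergent (u := z) (v := 1 - z) h0 (by simpa using h1)
  rw [intervalIntegrable_iff_integrableOn_Ioo_of_le zero_le_one, ← image_div_one_add_Ioi,
    integrableOn_image_iff_integrableOn_abs_deriv_smul measurableSet_Ioi
      (fun s hs => (hasDerivAt_div_one_add hs).hasDerivWithinAt) injOn_div_one_add_Ioi] at hb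
  exact hb.congr_fun (fun s hs => smul_beta_integrand hs) measurableSet_Ioi

/-- The substitution `u = s / (1 + s)` gives the Beta integral `B(z, 1 - z)`, which Euler's
reflection formula evaluates. -/
theorem mellin_inv_one_add {z : ℂ} (h0 : 0 < z.re) (h1 : z.re < 1) :
    mellin (fun s : ℝ => (((1 + s)⁻¹ : ℝ) : ℂ)) z = Real.pi / Complex.sin (Real.pi * z) := by
  have hb := Complex.Gamma_mul_Gamma_eq_betaIntegral (s := z) (t := 1 - z) h0 (by simpa using h1)
  rw [Complex.Gamma_mul_Gamma_one_sub, add_sub_cancel, Complex.Gamma_one, one_mul] at hb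
  rw [hb, Complex.betaIntegral, intervalIntegral.integral_of_le zero_le_one,
    integral_Ioc_eq_integral_Ioo, ← image_div_one_add_Ioi,
    integral_image_eq_integral_abs_deriv_smul measurableSet_Ioi
      (fun s hs => (hasDerivAt_div_one_add hs).hasDerivWithinAt) injOn_div_one_add_Ioi]
  exact (setIntegral_congr_fun measurableSet_Ioi fun s hs => smul_beta_integrand hs).symm

theorem inv_add_mul_eq {x y : ℝ} (hy : 0 < y) (s : ℝ) :
    ((y + s * x)⁻¹ : ℝ) = y⁻¹ * (1 + x / y * s)⁻¹ := by
  rw [← mul_inv]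
  congr 1
  field_simp

theorem mellinConvergent_inv_add_mul {x y : ℝ} (hx : 0 < x) (hy : 0 < y) {z : ℂ} (h0 : 0 < z.re)
    (h1 : z.re < 1) : MellinConvergent (fun s : ℝ => (((y + s * x)⁻¹ : ℝ) : ℂ)) z := by
  have h := ((MellinConvergent.comp_mul_left (div_pos hx hy)).2
    (mellinConvergent_inv_one_add h0 h1)).const_smul ((y⁻¹ : ℝ) : ℂ)
  simpa only [inv_add_mul_eq hy, Complex.ofReal_mul (y⁻¹), smul_eq_mul] using h

theorem mellin_inv_add_mul {x y : ℝ} (hx : 0 < x) (hy : 0 < y) {z : ℂ} (h0 : 0 < z.re)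
    (h1 : z.re < 1) : mellin (fun s : ℝ => (((y + s * x)⁻¹ : ℝ) : ℂ)) z =
      Real.pi / Complex.sin (Real.pi * z) * ((x : ℂ) ^ (-z) * (y : ℂ) ^ (z - 1)) := by
  have hyc : (y : ℂ) ≠ 0 := by exact_mod_cast hy.ne'
  simp only [inv_add_mul_eq hy, Complex.ofReal_mul (y⁻¹)]
  rw [show (fun s : ℝ => ((y⁻¹ : ℝ) : ℂ) * (((1 + x / y * s)⁻¹ : ℝ) : ℂ)) =
    fun s : ℝ => ((y⁻¹ : ℝ) : ℂ) • (((1 + x / y * s)⁻¹ : ℝ) : ℂ) from rfl, mellin_const_smul,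
    mellin_comp_mul_left (fun s : ℝ => (((1 + s)⁻¹ : ℝ) : ℂ)) z (div_pos hx hy),
    mellin_inv_one_add h0 h1, div_eq_mul_inv x y, Complex.ofReal_mul,
    Complex.mul_cpow_ofReal_nonneg hx.le (by positivity), smul_eq_mul, smul_eq_mul,
    Complex.ofReal_inv, Complex.inv_cpow _ _
      (by simp [Complex.arg_ofReal_of_nonneg hy.le, Real.pi_ne_zero.symm]),
    Complex.cpow_neg (y : ℂ) z,
    Complex.cpow_sub _ _ hyc, Complex.cpow_one, inv_inv]
  field_simp

theorem sin_pi_mul_half_sub (t : ℝ) :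
    Complex.sin (Real.pi * (1 / 2 - Complex.I * t)) = (Real.cosh (Real.pi * t) : ℝ) := by
  rw [show (Real.pi * (1 / 2 - Complex.I * t) : ℂ) = Real.pi / 2 - (Real.pi * t : ℝ) * Complex.I by
    push_cast; ring, Complex.sin_pi_div_two_sub, Complex.cos_mul_I, Complex.ofReal_cosh]

theorem norm_cpow_half {s : ℝ} (hs : 0 < s) (t : ℝ) :
    ‖(s : ℂ) ^ ((1 / 2 - Complex.I * t : ℂ) - 1)‖ = (√s)⁻¹ := by
  rw [Complex.norm_cpow_eq_rpow_re_of_pos hs, Real.sqrt_eq_rpow, ← Real.rpow_neg hs.le]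
  congr 1
  simp
  norm_num

theorem integrableOn_inv_of_le {f : ℝ → ℝ} {c : ℝ} (hc : 0 < c) (hf : ContinuousOn f (Ioi 0))
    (h : ∀ s, 0 < s → c * (1 + s ^ 2) ≤ f s) : IntegrableOn (fun s => (f s)⁻¹) (Ioi 0) := by
  have hpos : ∀ s, 0 < s → 0 < f s := fun s hs => lt_of_lt_of_le (by positivity) (h s hs)
  have hg : IntegrableOn (fun s : ℝ => c⁻¹ * (1 + s ^ 2)⁻¹) (Ioi 0) :=
    (integrable_inv_one_add_sq.const_mul _).integrableOn
  refine hg.mono' ((hf.inv₀ fun s hs => (hpos s hs).ne').aestronglyMeasurable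
    measurableSet_Ioi) ?_
  refine (ae_restrict_iff' measurableSet_Ioi).2 (Filter.Eventually.of_forall fun s hs => ?_)
  rw [Real.norm_of_nonneg (inv_nonneg.2 (hpos s hs).le), ← mul_inv]
  exact inv_anti₀ (by positivity) (h s hs)

theorem integrableOn_inv_add_mul_add {x y : ℝ} (hx : 0 < x) (hy : 0 < y) :
    IntegrableOn (fun s : ℝ => ((x + s) * (y + s))⁻¹) (Ioi 0) := by
  refine integrableOn_inv_of_le (c := min (x * y) 1) (by positivity) (by fun_prop) fun s hs => ?_
  have h1 := min_le_left (x * y) 1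
  have h2 := mul_le_mul_of_nonneg_right (min_le_right (x * y) 1) (sq_nonneg s)
  have h3 : 0 < s * x := by positivity
  have h4 : 0 < s * y := by positivity
  linarith

theorem integrableOn_inv_add_mul_one_add {x y : ℝ} (hx : 0 < x) (hy : 0 < y) :
    IntegrableOn (fun s : ℝ => ((y + s * x) * (1 + s))⁻¹) (Ioi 0) := by
  refine integrableOn_inv_of_le (c := min x y) (by positivity) (by fun_prop) fun s hs => ?_
  have h1 := min_le_right x y
  have h2 := mul_le_mul_of_nonneg_right (min_le_left x y) (sq_nonneg s)
  have h3 : 0 < s * x := by positivity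
  have h4 : 0 < s * y := by positivity
  linarith

/-- The substitution `s ↦ x s` makes the denominators of the BKM integrand those of the Lyapunov
solution, with a weight `1 / (1 + s)` independent of the eigenvalues. -/
theorem integral_inv_add_mul_add {x y : ℝ} (hx : 0 < x) :
    ∫ s in Ioi (0 : ℝ), ((x + s) * (y + s))⁻¹ = ∫ s in Ioi (0 : ℝ), ((y + s * x) * (1 + s))⁻¹ := by
  have h := integral_comp_mul_left_Ioi (fun s : ℝ => ((x + s) * (y + s))⁻¹) 0 hx
  rw [mul_zero, smul_eq_mul] at h
  rw [← inv_mul_eq_iff_eq_mul₀ (inv_ne_zero hx.ne'), inv_inv, ← integral_const_mul] at h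
  rw [← h]
  refine setIntegral_congr_fun measurableSet_Ioi fun s _ => ?_
  rw [show (x + x * s) * (y + x * s) = x * ((y + s * x) * (1 + s)) by ring, mul_inv x,
    mul_inv_cancel_left₀ hx.ne']

end ScalarIntegrals

/-! ### The BKM metric and the Mellin transform via Lyapunov equations. -/

section Metric

open MeasureTheory Set

variable {n : Type*} [Fintype n] [DecidableEq n] {M : Matrix n n ℂ}

/-- The solution `T` of `T M + s M T = A`. -/
noncomputable def lyapunovSolution (hM : M.IsHermitian) (s : ℝ) (A : Matrix n n ℂ) :
    Matrix n n ℂ :=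
  schurFun hM (fun x y => (((y + s * x)⁻¹ : ℝ) : ℂ)) A

theorem lyapunovSolution_mul_add (hM : M.IsHermitian) {s : ℝ} (hs : 0 ≤ s) {A : Matrix n n ℂ}
    (hA : IsSupported hM A) :
    lyapunovSolution hM s A * M + (s : ℂ) • (M * lyapunovSolution hM s A) = A := by
  apply eigenConj_injective hM
  rw [lyapunovSolution, schurFun_mul, mul_schurFun]
  have hadd : ∀ X Y : Matrix n n ℂ, eigenConj hM (X + (s : ℂ) • Y) =
      eigenConj hM X + (s : ℂ) • eigenConj hM Y := by
    intro X Y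
    simp [eigenConj, Matrix.mul_add, Matrix.add_mul]
  rw [hadd, eigenConj_schurFun, eigenConj_schurFun]
  ext i j
  simp only [Matrix.add_apply, Matrix.smul_apply, Matrix.of_apply, smul_eq_mul]
  -- Where both eigenvalues vanish the multiplier takes the default value `0⁻¹ = 0`; support of `A`
  -- makes those entries irrelevant.
  by_cases h : eigenConj hM A i j = 0
  · simp [h]
  · obtain ⟨hi, hj⟩ := hA i j h
    have hne : ((hM.eigenvalues j + s * hM.eigenvalues i : ℝ) : ℂ) ≠ 0 := by
      have : 0 < hM.eigenvalues j + s * hM.eigenvalues i := by positivity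
      exact_mod_cast this.ne'
    push_cast at hne ⊢
    field_simp

theorem inv_add_smul_one (hM : M.PosSemidef) {s : ℝ} (hs : 0 < s) :
    (M + (s : ℂ) • (1 : Matrix n n ℂ))⁻¹ = hermFun (fun x => (((x + s)⁻¹ : ℝ) : ℂ)) M := by
  apply Matrix.inv_eq_left_inv
  apply eigenConj_injective hM.1
  have hadd : eigenConj hM.1 (M + (s : ℂ) • (1 : Matrix n n ℂ)) =
      eigenConj hM.1 M + (s : ℂ) • (1 : Matrix n n ℂ) := by
    simp [eigenConj, Matrix.mul_add, Matrix.add_mul, eigenvectorUnitary_conjTranspose_mul]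
  have hone : eigenConj hM.1 (1 : Matrix n n ℂ) = 1 := by
    simp [eigenConj, eigenvectorUnitary_conjTranspose_mul]
  rw [eigenConj_mul, hadd, eigenConj_hermFun, eigenConj_self, hone, ← Matrix.diagonal_one,
    ← Matrix.diagonal_smul, Matrix.diagonal_add, Matrix.diagonal_mul_diagonal]
  congr 1
  ext i
  have h : 0 < hM.1.eigenvalues i + s := by have := hM.eigenvalues_nonneg i; positivity
  have hne : ((hM.1.eigenvalues i + s : ℝ) : ℂ) ≠ 0 := by exact_mod_cast h.ne'
  simp only [Pi.smul_apply, smul_eq_mul, mul_one]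
  push_cast at hne ⊢
  exact inv_mul_cancel₀ hne

theorem bkmIntegrand_eq_sum (hM : M.PosSemidef) {s : ℝ} (hs : 0 < s) (A : Matrix n n ℂ) :
    bkmIntegrand M A s = ∑ i, ∑ j, ((hM.1.eigenvalues i + s) * (hM.1.eigenvalues j + s))⁻¹ *
      ‖eigenConj hM.1 A i j‖ ^ 2 := by
  have h := re_trace_conjTranspose_mul_schurFun hM.1 (fun x y => ((x + s) * (y + s))⁻¹) A
  rw [← h, bkmIntegrand, inv_add_smul_one hM hs, Matrix.mul_assoc, Matrix.mul_assoc,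
    ← Matrix.mul_assoc _ A, hermFun_mul_mul_hermFun hM.1]
  simp only [mul_inv, Complex.ofReal_mul]

theorem re_trace_lyapunovSolution (hM : M.IsHermitian) (s : ℝ) (A : Matrix n n ℂ) :
    (Aᴴ * lyapunovSolution hM s A).trace.re =
      ∑ i, ∑ j, (hM.eigenvalues j + s * hM.eigenvalues i)⁻¹ * ‖eigenConj hM A i j‖ ^ 2 :=
  re_trace_conjTranspose_mul_schurFun hM (fun x y => (y + s * x)⁻¹) A

theorem integrableOn_bkmIntegrand (hM : M.PosSemidef) {A : Matrix n n ℂ}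
    (hA : IsSupported hM.1 A) : IntegrableOn (bkmIntegrand M A) (Ioi 0) := by
  refine IntegrableOn.congr_fun ?_ (fun s hs => (bkmIntegrand_eq_sum hM hs A).symm)
    measurableSet_Ioi
  refine integrable_finsetSum _ fun i _ => integrable_finsetSum _ fun j _ => ?_
  by_cases h : eigenConj hM.1 A i j = 0
  · simp [h]
  · exact (integrableOn_inv_add_mul_add (hA i j h).1 (hA i j h).2).mul_const _

theorem integrableOn_re_trace_lyapunovSolution (hM : M.IsHermitian) {A : Matrix n n ℂ}
    (hA : IsSupported hM A) :
    IntegrableOn (fun s => (Aᴴ * lyapunovSolution hM s A).trace.re * (1 + s)⁻¹) (Ioi 0) := by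
  simp only [re_trace_lyapunovSolution, Finset.sum_mul]
  refine integrable_finsetSum _ fun i _ => integrable_finsetSum _ fun j _ => ?_
  by_cases h : eigenConj hM A i j = 0
  · simp [h]
  · refine ((integrableOn_inv_add_mul_one_add (hA i j h).1 (hA i j h).2).mul_const
      (‖eigenConj hM A i j‖ ^ 2)).congr (Filter.Eventually.of_forall fun s => ?_)
    simp only [mul_inv]
    ring

theorem bkmMetric_eq_integral (hM : M.PosSemidef) {A : Matrix n n ℂ} (hA : IsSupported hM.1 A) :
    bkmMetric M A =
      ∫ s in Ioi (0 : ℝ), (Aᴴ * lyapunovSolution hM.1 s A).trace.re * (1 + s)⁻¹ := by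
  have h1 : bkmMetric M A = ∫ s in Ioi (0 : ℝ), ∑ i, ∑ j,
      ((hM.1.eigenvalues i + s) * (hM.1.eigenvalues j + s))⁻¹ * ‖eigenConj hM.1 A i j‖ ^ 2 :=
    setIntegral_congr_fun measurableSet_Ioi fun s hs => bkmIntegrand_eq_sum hM hs A
  have h2 : ∫ s in Ioi (0 : ℝ), (Aᴴ * lyapunovSolution hM.1 s A).trace.re * (1 + s)⁻¹ =
      ∫ s in Ioi (0 : ℝ), ∑ i, ∑ j, ((hM.1.eigenvalues j + s * hM.1.eigenvalues i) * (1 + s))⁻¹ *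
        ‖eigenConj hM.1 A i j‖ ^ 2 := by
    refine setIntegral_congr_fun measurableSet_Ioi fun s _ => ?_
    simp only [re_trace_lyapunovSolution, Finset.sum_mul, mul_inv]
    exact Finset.sum_congr rfl fun i _ => Finset.sum_congr rfl fun j _ => by ring
  have i1 : ∀ i j, IntegrableOn (fun s => ((hM.1.eigenvalues i + s) *
      (hM.1.eigenvalues j + s))⁻¹ * ‖eigenConj hM.1 A i j‖ ^ 2) (Ioi 0) := by
    intro i j
    by_cases h : eigenConj hM.1 A i j = 0
    · simp [h]
    · exact (integrableOn_inv_add_mul_add (hA i j h).1 (hA i j h).2).mul_const _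
  have i2 : ∀ i j, IntegrableOn (fun s => ((hM.1.eigenvalues j + s * hM.1.eigenvalues i) *
      (1 + s))⁻¹ * ‖eigenConj hM.1 A i j‖ ^ 2) (Ioi 0) := by
    intro i j
    by_cases h : eigenConj hM.1 A i j = 0
    · simp [h]
    · exact (integrableOn_inv_add_mul_one_add (hA i j h).1 (hA i j h).2).mul_const _
  rw [h1, h2, integral_finsetSum _ fun i _ => integrable_finsetSum _ fun j _ => i1 i j,
    integral_finsetSum _ fun i _ => integrable_finsetSum _ fun j _ => i2 i j]
  refine Finset.sum_congr rfl fun i _ => ?_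
  rw [integral_finsetSum _ fun j _ => i1 i j, integral_finsetSum _ fun j _ => i2 i j]
  refine Finset.sum_congr rfl fun j _ => ?_
  by_cases h : eigenConj hM.1 A i j = 0
  · simp [h]
  · rw [integral_mul_const, integral_mul_const, integral_inv_add_mul_add (hA i j h).1]

theorem suppPow_neg_one (hM : M.PosSemidef) :
    suppPow M (-1) = hermFun (fun x => ((x⁻¹ : ℝ) : ℂ)) M := by
  refine hermFun_congr hM.1 fun i => ?_
  split_ifs with h
  · rw [Complex.cpow_neg_one, Complex.ofReal_inv]
  · rw [le_antisymm (not_lt.1 h) (hM.eigenvalues_nonneg i)]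
    simp

theorem suppPow_neg_two (hM : M.PosSemidef) :
    suppPow M (-2) = hermFun (fun x => (((x ^ 2)⁻¹ : ℝ) : ℂ)) M := by
  refine hermFun_congr hM.1 fun i => ?_
  split_ifs with h
  · rw [Complex.cpow_neg]
    norm_cast
  · rw [le_antisymm (not_lt.1 h) (hM.eigenvalues_nonneg i)]
    simp

theorem hermFun_mul (hM : M.IsHermitian) (f : ℝ → ℂ) (A : Matrix n n ℂ) :
    hermFun f M * A = schurFun hM (fun x _ => f x) A := by
  apply eigenConj_injective hM
  rw [eigenConj_mul, eigenConj_schurFun, eigenConj_hermFun]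
  ext i j
  simp [Matrix.diagonal_mul]

theorem trace_suppPow_neg_one (hM : M.PosSemidef) (A : Matrix n n ℂ) :
    (Aᴴ * suppPow M (-1) * A).trace.re =
      ∑ i, ∑ j, (hM.1.eigenvalues i)⁻¹ * ‖eigenConj hM.1 A i j‖ ^ 2 := by
  rw [suppPow_neg_one hM, Matrix.mul_assoc, hermFun_mul hM.1]
  exact re_trace_conjTranspose_mul_schurFun hM.1 (fun x _ => x⁻¹) A

theorem trace_suppPow_neg_two (hM : M.PosSemidef) (A : Matrix n n ℂ) :
    (suppPow M (-2) * Aᴴ * M * A).trace.re =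
      ∑ i, ∑ j, hM.1.eigenvalues i * (hM.1.eigenvalues j ^ 2)⁻¹ *
        ‖eigenConj hM.1 A i j‖ ^ 2 := by
  have h := re_trace_conjTranspose_mul_schurFun hM.1 (fun x y => x * (y ^ 2)⁻¹) A
  rw [← h, Matrix.mul_assoc, Matrix.mul_assoc, Matrix.trace_mul_comm, suppPow_neg_two hM,
    Matrix.mul_assoc]
  nth_rewrite 1 [← hermFun_ofReal hM.1]
  rw [hermFun_mul_mul_hermFun hM.1]
  simp only [Complex.ofReal_mul]

/-- Entrywise `y + s x ≥ s x`: the bound used for large `s`. -/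
theorem weightedSq_lyapunovSolution_le_div (hM : M.PosSemidef) {A : Matrix n n ℂ}
    (hA : IsSupported hM.1 A) {s : ℝ} (hs : 0 < s) :
    weightedSq M (lyapunovSolution hM.1 s A) ≤ (Aᴴ * suppPow M (-1) * A).trace.re / s ^ 2 := by
  have h := weightedSq_schurFun hM.1 (fun x y => (y + s * x)⁻¹) A
  rw [trace_suppPow_neg_one hM, lyapunovSolution, h, Finset.sum_div]
  refine Finset.sum_le_sum fun i _ => ?_
  rw [Finset.sum_div]
  refine Finset.sum_le_sum fun j _ => ?_
  by_cases h : eigenConj hM.1 A i j = 0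
  · simp [h]
  obtain ⟨hi, hj⟩ := hA i j h
  set x := hM.1.eigenvalues i
  set y := hM.1.eigenvalues j
  rw [mul_div_right_comm]
  gcongr
  have : (y + s * x)⁻¹ ^ 2 ≤ (s * x)⁻¹ ^ 2 := by
    gcongr
    linarith
  calc x * (y + s * x)⁻¹ ^ 2 ≤ x * (s * x)⁻¹ ^ 2 := by gcongr
    _ = x⁻¹ / s ^ 2 := by field_simp

/-- Entrywise `y + s x ≥ y`: the bound used for small `s`. -/
theorem weightedSq_lyapunovSolution_le (hM : M.PosSemidef) {A : Matrix n n ℂ}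
    (hA : IsSupported hM.1 A) {s : ℝ} (hs : 0 < s) :
    weightedSq M (lyapunovSolution hM.1 s A) ≤ (suppPow M (-2) * Aᴴ * M * A).trace.re := by
  have h := weightedSq_schurFun hM.1 (fun x y => (y + s * x)⁻¹) A
  rw [trace_suppPow_neg_two hM, lyapunovSolution, h]
  refine Finset.sum_le_sum fun i _ => Finset.sum_le_sum fun j _ => ?_
  by_cases h : eigenConj hM.1 A i j = 0
  · simp [h]
  obtain ⟨hi, hj⟩ := hA i j h
  rw [← inv_pow]
  gcongr
  nlinarith

theorem mellin_lyapunovSolution (hM : M.PosSemidef) {A : Matrix n n ℂ}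
    (hA : IsSupported hM.1 A) (W : Matrix n n ℂ) (t : ℝ) :
    MellinConvergent (fun s => (Wᴴ * lyapunovSolution hM.1 s A).trace) (1 / 2 - Complex.I * t) ∧
    mellin (fun s => (Wᴴ * lyapunovSolution hM.1 s A).trace) (1 / 2 - Complex.I * t) =
      ((Real.pi / Real.cosh (Real.pi * t) : ℝ) : ℂ) *
        (Wᴴ * (suppPow M (-(1 / 2) + Complex.I * t) * A *
          suppPow M (-(1 / 2) - Complex.I * t))).trace := by
  set z : ℂ := 1 / 2 - Complex.I * t with hz
  have h0 : 0 < z.re := by simp [hz]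
  have h1 : z.re < 1 := by simp [hz]; norm_num
  set c : n → n → ℂ := fun i j => star (eigenConj hM.1 W i j) * eigenConj hM.1 A i j with hc
  have hsum : (fun s : ℝ => (Wᴴ * lyapunovSolution hM.1 s A).trace) = fun s : ℝ =>
      ∑ i, ∑ j, (((hM.1.eigenvalues j + s * hM.1.eigenvalues i)⁻¹ : ℝ) : ℂ) * c i j :=
    funext fun s => trace_conjTranspose_mul_schurFun hM.1 _ W A
  have hint : ∀ i j, IntegrableOn (fun s : ℝ => (s : ℂ) ^ (z - 1) •
      ((((hM.1.eigenvalues j + s * hM.1.eigenvalues i)⁻¹ : ℝ) : ℂ) * c i j)) (Ioi 0) := by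
    intro i j
    by_cases h : eigenConj hM.1 A i j = 0
    · simp [hc, h]
    · obtain ⟨hi, hj⟩ := hA i j h
      have := (mellinConvergent_inv_add_mul hi hj h0 h1).mul_const (c i j)
      simpa only [IntegrableOn, smul_eq_mul, mul_assoc] using this
  constructor
  · rw [hsum]
    simp only [MellinConvergent, Finset.smul_sum]
    exact integrable_finsetSum _ fun i _ => integrable_finsetSum _ fun j _ => hint i j
  · rw [hsum, suppPow, suppPow, hermFun_mul_mul_hermFun hM.1, trace_conjTranspose_mul_schurFun]
    simp only [mellin, Finset.smul_sum, Finset.mul_sum]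
    rw [integral_finsetSum _ fun i _ => integrable_finsetSum _ fun j _ => hint i j]
    refine Finset.sum_congr rfl fun i _ => ?_
    rw [integral_finsetSum _ fun j _ => hint i j]
    refine Finset.sum_congr rfl fun j _ => ?_
    by_cases h : eigenConj hM.1 A i j = 0
    · simp [hc, h]
    · obtain ⟨hi, hj⟩ := hA i j h
      have hm := mellin_inv_add_mul hi hj h0 h1
      rw [mellin, hz, sin_pi_mul_half_sub, ← hz] at hm
      simp only [smul_eq_mul, ← mul_assoc] at hm ⊢
      rw [integral_mul_const, hm, if_pos hi, if_pos hj,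
        show -(1 / 2) + Complex.I * t = -z by rw [hz]; ring,
        show -(1 / 2) - Complex.I * t = z - 1 by rw [hz]; ring]
      simp only [hc]
      push_cast
      ring

end Metric

/-! ### Monotonicity of `tr(A* ρ⁻¹ A)`. -/

section Channel

variable {n m : Type*} [Fintype n] [DecidableEq n] [Fintype m] [DecidableEq m]
  {Φ : Matrix n n ℂ →ₗ[ℂ] Matrix m m ℂ} {ρ : Matrix n n ℂ}

theorem weightedSq_suppPow_neg_one_mul {M : Matrix n n ℂ} (hM : M.PosSemidef)
    (A : Matrix n n ℂ) :
    weightedSq M (suppPow M (-1) * A) = (Aᴴ * suppPow M (-1) * A).trace.re := by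
  have h := weightedSq_schurFun hM.1 (fun x _ => x⁻¹) A
  rw [trace_suppPow_neg_one hM, suppPow_neg_one hM, hermFun_mul hM.1, h]
  refine Finset.sum_congr rfl fun i _ => Finset.sum_congr rfl fun j _ => ?_
  rcases eq_or_ne (hM.1.eigenvalues i) 0 with h | h
  · simp [h]
  · field_simp

theorem mul_suppPow_neg_one (hρ : ρ.PosDef) : ρ * suppPow ρ (-1) = 1 := by
  rw [suppPow_neg_one hρ.posSemidef]
  nth_rewrite 1 [← hermFun_ofReal hρ.1]
  rw [hermFun_mul_hermFun hρ.1]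
  apply eigenConj_injective hρ.1
  have hone : eigenConj hρ.1 (1 : Matrix n n ℂ) = 1 := by
    simp [eigenConj, eigenvectorUnitary_conjTranspose_mul]
  rw [eigenConj_hermFun, hone, ← Matrix.diagonal_one]
  congr 1
  ext i
  rw [← Complex.ofReal_mul, mul_inv_cancel₀ (hρ.eigenvalues_pos i).ne', Complex.ofReal_one]

/-- Monotonicity of `A ↦ tr (A* ρ⁻¹ A)` under quantum channels. -/
theorem IsQuantumChannel.trace_suppPow_neg_one_map_le (hΦ : IsQuantumChannel Φ) (hρ : ρ.PosDef)
    (A : Matrix n n ℂ) :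
    ((Φ A)ᴴ * suppPow (Φ ρ) (-1) * Φ A).trace.re ≤ (Aᴴ * suppPow ρ (-1) * A).trace.re := by
  have hσ := hΦ.map_posSemidef hρ.posSemidef
  set S := suppPow (Φ ρ) (-1) * Φ A with hS
  have hb := weightedSq_suppPow_neg_one_mul hσ (Φ A)
  have ha := weightedSq_suppPow_neg_one_mul hρ.posSemidef A
  rw [← hb, ← ha, ← hS]
  -- The image quantity `b` equals `tr(A* Φ†(S))`, so Cauchy–Schwarz and the Schwarz inequality give
  -- `b ≤ √a √b`.
  rw [Matrix.mul_assoc, ← hS, ← trace_conjTranspose_mul_hsAdjoint] at hb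
  have hcs := norm_trace_weighted_le hρ.posSemidef (suppPow ρ (-1) * A) (hsAdjoint Φ S)
  have hself : (suppPow ρ (-1))ᴴ * ρ = 1 := by
    have h := congrArg Matrix.conjTranspose (mul_suppPow_neg_one hρ)
    rw [Matrix.conjTranspose_mul, hρ.1.eq, Matrix.conjTranspose_one] at h
    exact h
  rw [Matrix.conjTranspose_mul, Matrix.mul_assoc Aᴴ, hself, Matrix.mul_one] at hcs
  have h1 := (Complex.re_le_norm _).trans hcs
  have h2 := Real.sqrt_le_sqrt (hΦ.weightedSq_hsAdjoint_le hρ.posSemidef S)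
  rw [← hb] at h1
  set a := weightedSq ρ (suppPow ρ (-1) * A)
  set b := weightedSq (Φ ρ) S
  have hb0 : 0 ≤ b := weightedSq_nonneg hσ S
  have ha0 : 0 ≤ a := weightedSq_nonneg hρ.posSemidef _
  have h3 : b ≤ √a * √b := h1.trans (mul_le_mul_of_nonneg_left h2 (Real.sqrt_nonneg _))
  nlinarith [Real.sq_sqrt ha0, Real.sq_sqrt hb0, sq_nonneg (√a - √b), Real.sqrt_nonneg a]

end Channel

/-! ### Hölder's inequality for the trace norm. -/

section TraceNorm

variable {n : Type*} [Fintype n] [DecidableEq n]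

theorem weightedSq_le_of_isIdempotentElem {Q : Matrix n n ℂ} (hQ : Q.IsHermitian)
    (hQ2 : Q * Q = Q) (C : Matrix n n ℂ) : weightedSq Q C ≤ (Cᴴ * C).trace.re := by
  have h1 : (1 - Q)ᴴ * (1 - Q) = 1 - Q := by
    rw [Matrix.conjTranspose_sub, hQ.eq, Matrix.conjTranspose_one, Matrix.sub_mul, Matrix.mul_sub,
      Matrix.mul_sub, hQ2]
    simp
  have h2 : (1 - Q).PosSemidef := h1 ▸ Matrix.posSemidef_conjTranspose_mul_self (1 - Q)
  have h3 := weightedSq_nonneg h2 C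
  rw [weightedSq, Matrix.mul_sub, Matrix.sub_mul, Matrix.mul_one, Matrix.trace_sub,
    Complex.sub_re] at h3
  rw [weightedSq]
  linarith

/-- Polar decomposition: `W = X |X|⁻¹`, inverted on the support, satisfies `|X| = W* X`, and `W W*`
is a projection. So `tr |X| = tr((C* W)* D)`, to which Cauchy–Schwarz applies, and `W` does not
increase the Hilbert–Schmidt norm of `C*`. -/
theorem traceNorm_mul_le (C D : Matrix n n ℂ) :
    traceNorm (C * D) ≤ √(Cᴴ * C).trace.re * √(Dᴴ * D).trace.re := by
  set X := C * D with hX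
  have hH : (Xᴴ * X).PosSemidef := Matrix.posSemidef_conjTranspose_mul_self X
  set H := Xᴴ * X with hH_def
  set P := hermFun (fun x => (((√x)⁻¹ : ℝ) : ℂ)) H with hP
  have hPH : Pᴴ = P := by
    rw [hP, conjTranspose_hermFun hH.1]
    simp
  set W := X * P with hW
  have hWW : Wᴴ * W = P * H * P := by
    rw [hW, Matrix.conjTranspose_mul, hPH, hH_def]
    simp only [Matrix.mul_assoc]
  have hPHP : P * (P * H * P) = P := by
    rw [hP]
    nth_rewrite 3 [← hermFun_ofReal hH.1]
    rw [hermFun_mul_hermFun hH.1, hermFun_mul_hermFun hH.1, hermFun_mul_hermFun hH.1]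
    refine hermFun_congr hH.1 fun i => ?_
    rcases (hH.eigenvalues_nonneg i).eq_or_lt with h | h
    · simp [← h]
    · rw [← Complex.ofReal_mul, ← Complex.ofReal_mul, ← Complex.ofReal_mul]
      congr 1
      have h1 : √(hH.1.eigenvalues i) ≠ 0 := (Real.sqrt_pos.2 h).ne'
      have h2 := Real.mul_self_sqrt h.le
      field_simp
      rw [sq, h2]
  have hQ : (W * Wᴴ) * (W * Wᴴ) = W * Wᴴ := by
    calc (W * Wᴴ) * (W * Wᴴ) = W * (Wᴴ * W) * Wᴴ := by simp only [Matrix.mul_assoc]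
      _ = W * Wᴴ := by rw [hWW, hW, Matrix.mul_assoc X, hPHP]
  have habs : matAbs X = Wᴴ * X := by
    rw [hW, Matrix.conjTranspose_mul, hPH, Matrix.mul_assoc, ← hH_def, matAbs, ← hH_def]
    rw [hP]
    nth_rewrite 3 [← hermFun_ofReal hH.1]
    rw [hermFun_mul_hermFun hH.1]
    refine hermFun_congr hH.1 fun i => ?_
    rcases (hH.eigenvalues_nonneg i).eq_or_lt with h | h
    · simp [← h]
    · rw [← Complex.ofReal_mul]
      congr 1
      have h1 : √(hH.1.eigenvalues i) ≠ 0 := (Real.sqrt_pos.2 h).ne'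
      have h2 := Real.mul_self_sqrt h.le
      field_simp
      rw [sq, h2]
  have hfac : Wᴴ * X = (Cᴴ * W)ᴴ * D := by
    rw [Matrix.conjTranspose_mul Cᴴ, Matrix.conjTranspose_conjTranspose, Matrix.mul_assoc, ← hX]
  have hCW : ((Cᴴ * W)ᴴ * (Cᴴ * W)).trace.re ≤ (Cᴴ * C).trace.re := by
    have h := weightedSq_le_of_isIdempotentElem (Q := W * Wᴴ)
      (by simp [Matrix.IsHermitian, Matrix.conjTranspose_mul]) hQ C
    refine le_trans (le_of_eq ?_) h
    rw [weightedSq, Matrix.trace_mul_comm, Matrix.conjTranspose_mul,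
      Matrix.conjTranspose_conjTranspose]
    simp only [Matrix.mul_assoc]
  rw [traceNorm, habs, hfac]
  refine (Complex.re_le_norm _).trans ((norm_trace_conjTranspose_mul_le _ _).trans ?_)
  gcongr

theorem traceNorm_nonneg (X : Matrix n n ℂ) : 0 ≤ traceNorm X := by
  have hH : (Xᴴ * X).PosSemidef := Matrix.posSemidef_conjTranspose_mul_self X
  rw [traceNorm, matAbs, trace_hermFun hH.1, Complex.re_sum]
  exact Finset.sum_nonneg fun i _ => by simp

theorem conjTranspose_suppPow_mul_suppPow {M : Matrix n n ℂ} (hM : M.PosSemidef) {w : ℂ}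
    (hw : w.re = 1 / 2) : (suppPow M w)ᴴ * suppPow M w = M := by
  rw [suppPow, conjTranspose_hermFun hM.1, hermFun_mul_hermFun hM.1]
  conv_rhs => rw [← hermFun_ofReal hM.1]
  refine hermFun_congr hM.1 fun i => ?_
  split_ifs with h
  · change (starRingEnd ℂ) _ * _ = _
    rw [Complex.conj_mul', Complex.norm_cpow_eq_rpow_re_of_pos h, hw,
      ← Real.sqrt_eq_rpow, ← Complex.ofReal_pow, Real.sq_sqrt h.le]
  · rw [le_antisymm (not_lt.1 h) (hM.eigenvalues_nonneg i)]
    simp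

theorem suppPow_mul_suppPow_neg {ρ : Matrix n n ℂ} (hρ : ρ.PosDef) (w : ℂ) :
    suppPow ρ w * suppPow ρ (-w) = 1 := by
  rw [suppPow, suppPow, hermFun_mul_hermFun hρ.1]
  apply eigenConj_injective hρ.1
  have hone : eigenConj hρ.1 (1 : Matrix n n ℂ) = 1 := by
    simp [eigenConj, eigenvectorUnitary_conjTranspose_mul]
  rw [eigenConj_hermFun, hone, ← Matrix.diagonal_one]
  congr 1
  ext i
  have h := hρ.eigenvalues_pos i
  rw [if_pos h, if_pos h, Complex.cpow_neg, mul_inv_cancel₀]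
  simp [Complex.cpow_eq_zero_iff, h.ne']

end TraceNorm

/-! ### From the trace norm to the weighted recovery error. -/

section RecoveryError

variable {n m : Type*} [Fintype n] [DecidableEq n] [Fintype m] [DecidableEq m]

/-- The rotated recovery error `ρ^{-1/2+it} (A - ℛ^t(Φ(A))) ρ^{-1/2-it}`. -/
noncomputable def recoveryError (Φ : Matrix n n ℂ →ₗ[ℂ] Matrix m m ℂ) (ρ A : Matrix n n ℂ)
    (t : ℝ) : Matrix n n ℂ :=
  suppPow ρ (-(1 / 2) + Complex.I * t) * A * suppPow ρ (-(1 / 2) - Complex.I * t) -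
    hsAdjoint Φ (suppPow (Φ ρ) (-(1 / 2) + Complex.I * t) * Φ A *
      suppPow (Φ ρ) (-(1 / 2) - Complex.I * t))

/-- The difference is `ρ^(1/2-it) Z ρ^(1/2+it)` with `Z` the recovery error. Imaginary powers drop
out of Hilbert–Schmidt norms, and the last factor has norm `(tr ρ)^(1/2) = 1`. -/
theorem traceNorm_sub_rotatedPetz_le (Φ : Matrix n n ℂ →ₗ[ℂ] Matrix m m ℂ) {ρ : Matrix n n ℂ}
    (hρ : ρ.PosDef) (hρ_tr : ρ.trace = 1) (A : Matrix n n ℂ) (t : ℝ) :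
    traceNorm (A - rotatedPetz Φ ρ t (Φ A)) ≤ √(weightedSq ρ (recoveryError Φ ρ A t)) := by
  have h1 := suppPow_mul_suppPow_neg hρ (1 / 2 - Complex.I * t)
  have h2 := suppPow_mul_suppPow_neg hρ (-(1 / 2) - Complex.I * t)
  rw [show -(1 / 2 - Complex.I * t) = -(1 / 2) + Complex.I * (t : ℂ) by ring] at h1
  rw [show -(-(1 / 2) - Complex.I * t) = 1 / 2 + Complex.I * (t : ℂ) by ring] at h2
  have hfac : A - rotatedPetz Φ ρ t (Φ A) =
      (suppPow ρ (1 / 2 - Complex.I * t) * recoveryError Φ ρ A t) *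
        suppPow ρ (1 / 2 + Complex.I * t) := by
    rw [recoveryError, Matrix.mul_sub, Matrix.sub_mul, rotatedPetz]
    congr 1
    rw [← Matrix.mul_assoc, ← Matrix.mul_assoc, h1, Matrix.one_mul, Matrix.mul_assoc, h2,
      Matrix.mul_one]
  rw [hfac]
  refine (traceNorm_mul_le _ _).trans_eq ?_
  rw [conjTranspose_suppPow_mul_suppPow hρ.posSemidef (by simp), hρ_tr, Matrix.conjTranspose_mul,
    Matrix.mul_assoc, ← Matrix.mul_assoc _ _ (recoveryError Φ ρ A t),
    conjTranspose_suppPow_mul_suppPow hρ.posSemidef (by simp), ← Matrix.mul_assoc]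
  simp [weightedSq]

end RecoveryError

/-! ### Splitting the integral and optimizing the cutoff. -/

section RealEstimates

open MeasureTheory Set

theorem setIntegral_Ioc_inv_sqrt {a : ℝ} (ha : 0 < a) :
    IntegrableOn (fun s : ℝ => (√s)⁻¹) (Ioc 0 a) ∧ ∫ s in Ioc 0 a, (√s)⁻¹ = 2 * √a := by
  have hfun : ∀ s ∈ Ioc 0 a, s ^ (-(1 / 2) : ℝ) = (√s)⁻¹ := fun s hs => by
    rw [Real.sqrt_eq_rpow, Real.rpow_neg hs.1.le]
  have hint : IntegrableOn (fun s : ℝ => s ^ (-(1 / 2) : ℝ)) (Ioc 0 a) :=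
    (intervalIntegrable_iff_integrableOn_Ioc_of_le ha.le).1
      (intervalIntegral.intervalIntegrable_rpow' (by norm_num))
  refine ⟨hint.congr_fun hfun measurableSet_Ioc, ?_⟩
  rw [← setIntegral_congr_fun measurableSet_Ioc hfun, ← intervalIntegral.integral_of_le ha.le,
    integral_rpow (Or.inl (by norm_num)), Real.sqrt_eq_rpow, Real.zero_rpow (by norm_num)]
  norm_num
  ring

theorem setIntegral_Ioi_inv_sqrt_mul_inv {b : ℝ} (hb : 0 < b) :
    IntegrableOn (fun s : ℝ => (√s)⁻¹ * s⁻¹) (Ioi b) ∧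
      ∫ s in Ioi b, (√s)⁻¹ * s⁻¹ = 2 * (√b)⁻¹ := by
  have hfun : ∀ s ∈ Ioi b, s ^ (-(3 / 2) : ℝ) = (√s)⁻¹ * s⁻¹ := fun s hs => by
    have hs0 : 0 < s := hb.trans hs
    rw [Real.sqrt_eq_rpow, ← Real.rpow_neg hs0.le, ← Real.rpow_neg_one s, ← Real.rpow_add hs0]
    norm_num
  have hint : IntegrableOn (fun s : ℝ => s ^ (-(3 / 2) : ℝ)) (Ioi b) :=
    integrableOn_Ioi_rpow_of_lt (by norm_num) hb
  refine ⟨hint.congr_fun hfun measurableSet_Ioi, ?_⟩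
  rw [← setIntegral_congr_fun measurableSet_Ioi hfun, integral_Ioi_rpow_of_lt (by norm_num) hb,
    Real.sqrt_eq_rpow, ← Real.rpow_neg hb.le]
  norm_num
  ring

theorem setIntegral_Ioc_one_add_div_sq {a b : ℝ} (ha : 0 < a) (hab : a ≤ b) :
    IntegrableOn (fun s : ℝ => (1 + s) / s ^ 2) (Ioc a b) ∧
      ∫ s in Ioc a b, (1 + s) / s ^ 2 = Real.log b - Real.log a + a⁻¹ - b⁻¹ := by
  have hpos : ∀ s ∈ uIcc a b, s ≠ 0 := fun s hs => by
    rw [uIcc_of_le hab] at hs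
    exact (ha.trans_le hs.1).ne'
  have hint : IntervalIntegrable (fun s : ℝ => (1 + s) / s ^ 2) volume a b := by
    refine ContinuousOn.intervalIntegrable ?_
    exact ContinuousOn.div (by fun_prop) (by fun_prop) fun s hs => pow_ne_zero 2 (hpos s hs)
  refine ⟨(intervalIntegrable_iff_integrableOn_Ioc_of_le hab).1 hint, ?_⟩
  rw [← intervalIntegral.integral_of_le hab,
    intervalIntegral.integral_eq_sub_of_hasDerivAt (f := fun s => Real.log s - s⁻¹)
      (fun s hs => ?_) hint]
  · ring
  · have hs0 := hpos s hs
    refine ((Real.hasDerivAt_log hs0).sub (hasDerivAt_inv hs0)).congr_deriv ?_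
    field_simp
    ring

/-- The estimate of `∫ g(s) s^{-1/2} ds` by splitting at `a` and `1/a`. -/
theorem integral_inv_sqrt_mul_le {g d : ℝ → ℝ} {p q a : ℝ} (ha : 0 < a) (ha1 : a ≤ 1)
    (hg : IntegrableOn (fun s => (√s)⁻¹ * g s) (Ioi 0))
    (hd : IntegrableOn (fun s => d s * (1 + s)⁻¹) (Ioi 0))
    (hp : ∀ s, 0 < s → g s ≤ p) (hq : ∀ s, 0 < s → g s ≤ q * s⁻¹)
    (hgd : ∀ s, 0 < s → s * g s ^ 2 ≤ d s) :
    ∫ s in Ioi (0 : ℝ), (√s)⁻¹ * g s ≤ √a * (2 * (p + q)) +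
      √((∫ s in Ioi (0 : ℝ), d s * (1 + s)⁻¹) * (2 * Real.log a⁻¹ + a⁻¹ - a)) := by
  have hab : a ≤ a⁻¹ := ha1.trans ((one_le_inv₀ ha).2 ha1)
  have hb : 0 < a⁻¹ := inv_pos.2 ha
  have hd0 : ∀ s, 0 < s → 0 ≤ d s := fun s hs =>
    le_trans (by positivity) (hgd s hs)
  have hsub1 : Ioc 0 a ⊆ Ioi (0 : ℝ) := fun s hs => hs.1
  have hsub2 : Ioc a a⁻¹ ⊆ Ioi (0 : ℝ) := fun s hs => ha.trans hs.1
  have hsub3 : Ioi a⁻¹ ⊆ Ioi (0 : ℝ) := fun s hs => hb.trans hs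
  have hsubI : Ioi a ⊆ Ioi (0 : ℝ) := fun s hs => ha.trans hs
  have hsplit : ∫ s in Ioi (0 : ℝ), (√s)⁻¹ * g s = (∫ s in Ioc 0 a, (√s)⁻¹ * g s) +
      ((∫ s in Ioc a a⁻¹, (√s)⁻¹ * g s) + ∫ s in Ioi a⁻¹, (√s)⁻¹ * g s) := by
    rw [← setIntegral_union (Ioc_disjoint_Ioi le_rfl) measurableSet_Ioi (hg.mono_set hsub2)
      (hg.mono_set hsub3), Ioc_union_Ioi_eq_Ioi hab,
      ← setIntegral_union (Ioc_disjoint_Ioi le_rfl) measurableSet_Ioi (hg.mono_set hsub1)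
      (hg.mono_set hsubI), Ioc_union_Ioi_eq_Ioi ha.le]
  have hsmall : ∫ s in Ioc 0 a, (√s)⁻¹ * g s ≤ 2 * √a * p := by
    obtain ⟨h1, h2⟩ := setIntegral_Ioc_inv_sqrt ha
    rw [← h2, ← integral_mul_const]
    refine setIntegral_mono_on (hg.mono_set hsub1) (h1.mul_const p) measurableSet_Ioc
      fun s hs => ?_
    exact mul_le_mul_of_nonneg_left (hp s hs.1) (by positivity)
  have hlarge : ∫ s in Ioi a⁻¹, (√s)⁻¹ * g s ≤ 2 * √a * q := by
    obtain ⟨h1, h2⟩ := setIntegral_Ioi_inv_sqrt_mul_inv hb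
    rw [Real.sqrt_inv, inv_inv] at h2
    rw [← h2, ← integral_mul_const]
    refine setIntegral_mono_on (hg.mono_set hsub3) (h1.mul_const q) measurableSet_Ioi
      fun s hs => ?_
    have := mul_le_mul_of_nonneg_left (hq s (hsub3 hs)) (inv_nonneg.2 (Real.sqrt_nonneg s))
    linarith
  have hmid : ∫ s in Ioc a a⁻¹, (√s)⁻¹ * g s ≤
      √((∫ s in Ioi (0 : ℝ), d s * (1 + s)⁻¹) * (2 * Real.log a⁻¹ + a⁻¹ - a)) := by
    obtain ⟨h1, h2⟩ := setIntegral_Ioc_one_add_div_sq ha hab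
    have hL : 2 * Real.log a⁻¹ + a⁻¹ - a = ∫ s in Ioc a a⁻¹, (1 + s) / s ^ 2 := by
      rw [h2, Real.log_inv, inv_inv]; ring
    have hDle : ∫ s in Ioc a a⁻¹, d s * (1 + s)⁻¹ ≤ ∫ s in Ioi (0 : ℝ), d s * (1 + s)⁻¹ := by
      refine setIntegral_mono_set hd ?_ hsub2.eventuallyLE
      refine (ae_restrict_iff' measurableSet_Ioi).2 (Filter.Eventually.of_forall fun s hs => ?_)
      have hs0 : 0 < s := hs
      exact mul_nonneg (hd0 s hs0) (by positivity)
    rw [hL]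
    set D := ∫ s in Ioi (0 : ℝ), d s * (1 + s)⁻¹
    set I := ∫ s in Ioc a a⁻¹, (√s)⁻¹ * g s with hI
    set L := ∫ s in Ioc a a⁻¹, (1 + s) / s ^ 2 with hLdef
    -- Cauchy–Schwarz in discriminant form: the integrand below is a nonnegative multiple of `d s -
    -- s * g s ^ 2` plus a square, so this quadratic in `κ` has no sign change and `I ^ 2 ≤ D * L`.
    have hquad : ∀ κ : ℝ, 0 ≤ D * (κ * κ) + (-2 * I) * κ + L := by
      intro κ
      have h3 : IntegrableOn (fun s => d s * (1 + s)⁻¹) (Ioc a a⁻¹) := hd.mono_set hsub2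
      have h4 : IntegrableOn (fun s => (√s)⁻¹ * g s) (Ioc a a⁻¹) := hg.mono_set hsub2
      have h5 : 0 ≤ ∫ s in Ioc a a⁻¹, (d s * (1 + s)⁻¹ * (κ * κ) +
          (√s)⁻¹ * g s * (-2 * κ) + (1 + s) / s ^ 2) := by
        refine setIntegral_nonneg measurableSet_Ioc fun s hs => ?_
        have hs0 : 0 < s := hsub2 hs
        have hr : 0 < √s := Real.sqrt_pos.2 hs0
        have hr2 : √s ^ 2 = s := Real.sq_sqrt hs0.le
        have e : d s * (1 + s)⁻¹ * (κ * κ) + (√s)⁻¹ * g s * (-2 * κ) + (1 + s) / s ^ 2 =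
            (d s - s * g s ^ 2) * (1 + s)⁻¹ * κ ^ 2 +
            (√s * g s * κ - (1 + s) / s) ^ 2 * (1 + s)⁻¹ := by
          have h1s : 1 + s ≠ 0 := by positivity
          have hi : (√s)⁻¹ = √s / s := by
            rw [eq_div_iff hs0.ne']; nth_rewrite 2 [← hr2]; field_simp
          rw [hi]
          field_simp
          linear_combination (-s ^ 2 * κ ^ 2 * g s ^ 2) * hr2
        rw [e]
        have := sub_nonneg.2 (hgd s hs0)
        positivity
      have h34 : IntegrableOn (fun s => d s * (1 + s)⁻¹ * (κ * κ) + (√s)⁻¹ * g s * (-2 * κ))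
          (Ioc a a⁻¹) := (h3.mul_const _).add (h4.mul_const _)
      rw [integral_add h34 h1,
        integral_add (h3.mul_const _) (h4.mul_const _), integral_mul_const,
        integral_mul_const, ← hI, ← hLdef] at h5
      have h6 := mul_le_mul_of_nonneg_right hDle (mul_self_nonneg κ)
      linarith
    have hdisc := discrim_le_zero hquad
    rw [discrim] at hdisc
    refine Real.le_sqrt_of_sq_le ?_
    linarith
  rw [hsplit]
  linarith

/-- This is `u ≤ exp (u - 1)` at `u = ε log x⁻¹`; it is the source of `ε e` in the constant. -/
theorem log_inv_le_rpow {x ε : ℝ} (hx : 0 < x) (hε : 0 < ε) :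
    Real.log x⁻¹ ≤ x ^ (-ε) * (ε * Real.exp 1)⁻¹ := by
  have h := Real.add_one_le_exp (ε * Real.log x⁻¹ - 1)
  rw [sub_add_cancel, Real.exp_sub, mul_comm ε, ← Real.rpow_def_of_pos (inv_pos.2 hx),
    Real.inv_rpow hx.le, ← Real.rpow_neg hx.le, le_div_iff₀ (Real.exp_pos 1)] at h
  rw [← div_eq_mul_inv, le_div_iff₀ (by positivity)]
  linarith

/-- The cutoff is `a → 0` if `D = 0`, `a = 1` if `D ≥ 1`, and `a = √D` otherwise. In the last case
the terms have orders `D^(1/4)` and `D^((1-ε)/2)`; both exponents are at least `(1-2ε)/4`, so both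
powers are dominated since `D < 1`. -/
theorem le_mul_rpow_of_forall_le {x N D ε : ℝ} (hD : 0 ≤ D) (hN : 0 ≤ N) (hε : 0 < ε)
    (hε2 : ε < 1 / 2)
    (h : ∀ a, 0 < a → a ≤ 1 → x ≤ √a * N + √(D * (2 * Real.log a⁻¹ + a⁻¹ - a))) :
    x ≤ (N + 1 + (ε * Real.exp 1) ^ (-(1 / 2) : ℝ)) * D ^ ((1 - 2 * ε) / 4) := by
  have hK : 0 ≤ (ε * Real.exp 1) ^ (-(1 / 2) : ℝ) := by positivity
  rcases hD.eq_or_lt with h0 | h0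
  · rw [← h0, Real.zero_rpow (by linarith), mul_zero]
    have ht : Filter.Tendsto (fun a : ℝ => √a * N) (nhdsWithin 0 (Ioi 0)) (nhds 0) := by
      have : Continuous fun a : ℝ => √a * N := by fun_prop
      simpa using (this.tendsto 0).mono_left nhdsWithin_le_nhds
    refine ge_of_tendsto ht ?_
    filter_upwards [Ioo_mem_nhdsGT (zero_lt_one' ℝ)] with a ha
    simpa [← h0] using h a ha.1 ha.2.le
  rcases le_or_gt 1 D with h1 | h1
  · have h2 := h 1 one_pos le_rfl
    simp at h2
    have h3 : 1 ≤ D ^ ((1 - 2 * ε) / 4) := Real.one_le_rpow h1 (by linarith)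
    nlinarith
  · have hsD : 0 < √D := Real.sqrt_pos.2 h0
    have h2 := h (√D) hsD (Real.sqrt_le_one.2 h1.le)
    have hlog : 2 * Real.log (√D)⁻¹ = Real.log D⁻¹ := by
      rw [Real.log_inv, Real.log_inv, Real.log_sqrt hD]; ring
    have hDD : D * (√D)⁻¹ = √D := by
      rw [← div_eq_mul_inv, Real.div_sqrt]
    have h3 : √(√D) = D ^ (1 / 4 : ℝ) := by
      rw [Real.sqrt_eq_rpow, Real.sqrt_eq_rpow, ← Real.rpow_mul hD]; norm_num
    have h4 : √(D * (2 * Real.log (√D)⁻¹ + (√D)⁻¹ - √D)) ≤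
        √(D * Real.log D⁻¹) + D ^ (1 / 4 : ℝ) := by
      rw [← h3]
      have hu : 0 ≤ D * Real.log D⁻¹ :=
        mul_nonneg hD (Real.log_nonneg ((one_le_inv₀ h0).2 h1.le))
      refine Real.sqrt_le_iff.2 ⟨by positivity, ?_⟩
      rw [hlog, add_sq, Real.sq_sqrt hu, Real.sq_sqrt hsD.le]
      have := mul_nonneg (Real.sqrt_nonneg (D * Real.log D⁻¹)) (Real.sqrt_nonneg (√D))
      nlinarith
    have h5 : √(D * Real.log D⁻¹) ≤
        D ^ ((1 - ε) / 2) * (ε * Real.exp 1) ^ (-(1 / 2) : ℝ) := by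
      have h6 : D * Real.log D⁻¹ ≤ D ^ (1 - ε) * (ε * Real.exp 1)⁻¹ := by
        rw [sub_eq_add_neg, Real.rpow_add h0, Real.rpow_one, mul_assoc]
        exact mul_le_mul_of_nonneg_left (log_inv_le_rpow h0 hε) hD
      refine (Real.sqrt_le_sqrt h6).trans_eq ?_
      rw [Real.sqrt_mul (by positivity), Real.sqrt_inv, Real.sqrt_eq_rpow, Real.sqrt_eq_rpow,
        ← Real.rpow_mul hD, ← Real.rpow_neg (by positivity)]
      congr 2
      ring
    have h7 : D ^ ((1 - ε) / 2) ≤ D ^ ((1 - 2 * ε) / 4) :=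
      Real.rpow_le_rpow_of_exponent_ge h0 h1.le (by linarith)
    have h8 : D ^ (1 / 4 : ℝ) ≤ D ^ ((1 - 2 * ε) / 4) :=
      Real.rpow_le_rpow_of_exponent_ge h0 h1.le (by linarith)
    rw [h3] at h2
    have h9 := mul_le_mul_of_nonneg_right h7 hK
    have h10 := mul_le_mul_of_nonneg_right h8 hN
    linarith

end RealEstimates

/-! ### The recovery bound. -/

section Recovery

open MeasureTheory Set

variable {n m : Type*} [Fintype n] [DecidableEq n] [Fintype m] [DecidableEq m]
  {Φ : Matrix n n ℂ →ₗ[ℂ] Matrix m m ℂ} {ρ : Matrix n n ℂ}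

theorem norm_trace_weighted_sub_le {M : Matrix n n ℂ} (hM : M.PosSemidef) {Z X Y : Matrix n n ℂ}
    {x y : ℝ} (hX : weightedSq M X ≤ x) (hY : weightedSq M Y ≤ y) :
    ‖(Zᴴ * M * (X - Y)).trace‖ ≤ √(weightedSq M Z) * (√x + √y) := by
  rw [Matrix.mul_sub, Matrix.trace_sub, mul_add]
  refine (norm_sub_le _ _).trans (add_le_add ?_ ?_)
  · exact (norm_trace_weighted_le hM Z X).trans (by gcongr)
  · exact (norm_trace_weighted_le hM Z Y).trans (by gcongr)

theorem IsQuantumChannel.recoveryError_bound (hΦ : IsQuantumChannel Φ) (hρ : ρ.PosDef)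
    (A : Matrix n n ℂ) (t : ℝ) {a : ℝ} (ha : 0 < a) (ha1 : a ≤ 1) :
    Real.pi / Real.cosh (Real.pi * t) * √(weightedSq ρ (recoveryError Φ ρ A t)) ≤
      √a * (4 * √(Aᴴ * suppPow ρ (-1) * A).trace.re
        + 2 * √(suppPow ρ (-2) * Aᴴ * ρ * A).trace.re
        + 2 * √(suppPow (Φ ρ) (-2) * (Φ A)ᴴ * Φ ρ * Φ A).trace.re) +
      √((bkmMetric ρ A - bkmMetric (Φ ρ) (Φ A)) * (2 * Real.log a⁻¹ + a⁻¹ - a)) := by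
  have hρ' := hρ.posSemidef
  have hσ := hΦ.map_posSemidef hρ'
  have hA := isSupported_of_posDef hρ A
  have hB := hΦ.isSupported_map hρ hσ.1 A
  set k₁ := √(Aᴴ * suppPow ρ (-1) * A).trace.re with hk₁
  set k₂ := √(suppPow ρ (-2) * Aᴴ * ρ * A).trace.re with hk₂
  set k₃ := √(suppPow (Φ ρ) (-2) * (Φ A)ᴴ * Φ ρ * Φ A).trace.re with hk₃
  set Z := recoveryError Φ ρ A t with hZ
  set ζ := √(weightedSq ρ Z) with hζ
  rcases (Real.sqrt_nonneg (weightedSq ρ Z)).eq_or_lt with h0 | hζ0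
  · rw [hζ, ← h0, mul_zero]
    positivity
  rw [← hζ] at hζ0
  set T := fun s => lyapunovSolution hρ.1 s A
  set S := fun s => lyapunovSolution hσ.1 s (Φ A)
  set d : ℝ → ℝ := fun s => (Aᴴ * T s).trace.re - ((Φ A)ᴴ * S s).trace.re with hd
  -- Pairing with `Z` itself makes the Mellin transform at `1/2 - it` equal to `π / cosh(πt) * ζ ^
  -- 2`; dividing by `ζ` leaves the desired norm and a scalar function to estimate.
  set ψ : ℝ → ℂ := fun s => (Zᴴ * ρ * (T s - hsAdjoint Φ (S s))).trace with hψ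
  have hDint := integrableOn_re_trace_lyapunovSolution hρ.1 hA
  have hDint' := integrableOn_re_trace_lyapunovSolution hσ.1 hB
  have hdint : IntegrableOn (fun s => d s * (1 + s)⁻¹) (Ioi 0) := by
    simp only [hd, sub_mul]
    exact hDint.sub hDint'
  have hD : bkmMetric ρ A - bkmMetric (Φ ρ) (Φ A) = ∫ s in Ioi (0 : ℝ), d s * (1 + s)⁻¹ := by
    rw [bkmMetric_eq_integral hρ' hA, bkmMetric_eq_integral hσ hB, ← integral_sub hDint hDint']
    simp only [hd, sub_mul, T, S]
  have hψ' : ψ = fun s => (((ρ * Z)ᴴ) * T s).trace - ((Φ (ρ * Z))ᴴ * S s).trace := by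
    ext s
    simp only [hψ]
    rw [← trace_conjTranspose_mul_hsAdjoint, ← Matrix.trace_sub, ← Matrix.mul_sub,
      Matrix.conjTranspose_mul, hρ.1.eq]
  obtain ⟨hT1, hT2⟩ := mellin_lyapunovSolution hρ' hA (ρ * Z) t
  obtain ⟨hS1, hS2⟩ := mellin_lyapunovSolution hσ hB (Φ (ρ * Z)) t
  have hmc : MellinConvergent ψ (1 / 2 - Complex.I * t) := by
    rw [hψ']
    exact (hasMellin_sub hT1 hS1).1
  have hm : mellin ψ (1 / 2 - Complex.I * t) =
      ((Real.pi / Real.cosh (Real.pi * t) : ℝ) : ℂ) * (Zᴴ * ρ * Z).trace := by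
    rw [hψ', (hasMellin_sub hT1 hS1).2, hT2, hS2, ← trace_conjTranspose_mul_hsAdjoint, ← mul_sub,
      ← Matrix.trace_sub, ← Matrix.mul_sub, ← recoveryError, ← hZ, Matrix.conjTranspose_mul,
      hρ.1.eq]
  have hcongr : ∀ s ∈ Ioi (0 : ℝ), ‖(s : ℂ) ^ ((1 / 2 - Complex.I * t : ℂ) - 1) • ψ s‖ =
      ζ * ((√s)⁻¹ * (‖ψ s‖ / ζ)) := fun s hs => by
    rw [norm_smul, norm_cpow_half hs]
    field_simp
  have hgint : IntegrableOn (fun s => (√s)⁻¹ * (‖ψ s‖ / ζ)) (Ioi 0) := by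
    have h := (IntegrableOn.congr_fun hmc.norm hcongr measurableSet_Ioi).const_mul ζ⁻¹
    refine IntegrableOn.congr_fun h (fun s _ => ?_) measurableSet_Ioi
    field_simp
  have hle : Real.pi / Real.cosh (Real.pi * t) * ζ ≤
      ∫ s in Ioi (0 : ℝ), (√s)⁻¹ * (‖ψ s‖ / ζ) := by
    have h1 : Real.pi / Real.cosh (Real.pi * t) * weightedSq ρ Z ≤
        ‖mellin ψ (1 / 2 - Complex.I * t)‖ := by
      rw [hm, weightedSq, ← Complex.re_ofReal_mul]
      exact Complex.re_le_norm _
    have h2 := h1.trans (norm_integral_le_integral_norm _)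
    rw [setIntegral_congr_fun measurableSet_Ioi hcongr, integral_const_mul,
      ← Real.sq_sqrt (weightedSq_nonneg hρ' Z), ← hζ] at h2
    refine le_of_mul_le_mul_left ?_ hζ0
    linarith
  have hp : ∀ s, 0 < s → ‖ψ s‖ / ζ ≤ k₂ + k₃ := fun s hs => by
    rw [div_le_iff₀' hζ0]
    exact norm_trace_weighted_sub_le hρ' (weightedSq_lyapunovSolution_le hρ' hA hs)
      ((hΦ.weightedSq_hsAdjoint_le hρ' _).trans (weightedSq_lyapunovSolution_le hσ hB hs))
  -- Monotonicity of `tr(A* ρ⁻¹ A)` bounds the `Φ(ρ)` contribution by `k₁` too. Together with the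
  -- factor `2` from the tail integral this gives the coefficient `4` in `K`.
  have hq : ∀ s, 0 < s → ‖ψ s‖ / ζ ≤ 2 * k₁ * s⁻¹ := fun s hs => by
    rw [div_le_iff₀' hζ0]
    have h1 := weightedSq_lyapunovSolution_le_div hρ' hA hs
    have h2 : weightedSq ρ (hsAdjoint Φ (S s)) ≤ (Aᴴ * suppPow ρ (-1) * A).trace.re / s ^ 2 :=
      (hΦ.weightedSq_hsAdjoint_le hρ' _).trans
        ((weightedSq_lyapunovSolution_le_div hσ hB hs).trans
          (div_le_div_of_nonneg_right (hΦ.trace_suppPow_neg_one_map_le hρ A) (sq_nonneg s)))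
    refine (norm_trace_weighted_sub_le hρ' h1 h2).trans_eq ?_
    rw [Real.sqrt_div' _ (sq_nonneg s), Real.sqrt_sq hs.le, ← hk₁, ← hζ]
    ring
  have hgd : ∀ s, 0 < s → s * (‖ψ s‖ / ζ) ^ 2 ≤ d s := fun s hs => by
    have h1 := hΦ.weightedSq_sub_le hρ' hs.le (lyapunovSolution_mul_add hρ.1 hs.le hA)
      (lyapunovSolution_mul_add hσ.1 hs.le hB)
    refine le_trans (mul_le_mul_of_nonneg_left ?_ hs.le) h1
    have h2 : ‖ψ s‖ / ζ ≤ √(weightedSq ρ (T s - hsAdjoint Φ (S s))) := by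
      rw [div_le_iff₀' hζ0]
      exact norm_trace_weighted_le hρ' Z _
    calc (‖ψ s‖ / ζ) ^ 2 ≤ √(weightedSq ρ (T s - hsAdjoint Φ (S s))) ^ 2 := by gcongr
      _ = _ := Real.sq_sqrt (weightedSq_nonneg hρ' _)
  have hmain := hle.trans (integral_inv_sqrt_mul_le ha ha1 hgint hdint hp hq hgd)
  rw [← hD] at hmain
  refine hmain.trans_eq ?_
  ring

theorem IsQuantumChannel.bkmMetric_map_le (hΦ : IsQuantumChannel Φ) (hρ : ρ.PosDef)
    (A : Matrix n n ℂ) : bkmMetric (Φ ρ) (Φ A) ≤ bkmMetric ρ A := by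
  have hρ' := hρ.posSemidef
  have hσ := hΦ.map_posSemidef hρ'
  have hA := isSupported_of_posDef hρ A
  have hB := hΦ.isSupported_map hρ hσ.1 A
  rw [bkmMetric_eq_integral hρ' hA, bkmMetric_eq_integral hσ hB]
  refine setIntegral_mono_on (integrableOn_re_trace_lyapunovSolution hσ.1 hB)
    (integrableOn_re_trace_lyapunovSolution hρ.1 hA) measurableSet_Ioi fun s hs => ?_
  have hs0 : 0 < s := hs
  have h1 := hΦ.weightedSq_sub_le hρ' hs0.le (lyapunovSolution_mul_add hρ.1 hs0.le hA)
    (lyapunovSolution_mul_add hσ.1 hs0.le hB)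
  have h2 := mul_nonneg hs0.le (weightedSq_nonneg hρ'
    (lyapunovSolution hρ.1 s A - hsAdjoint Φ (lyapunovSolution hσ.1 s (Φ A))))
  refine mul_le_mul_of_nonneg_right (by linarith) (by positivity)

theorem IsQuantumChannel.bkmLowerBound_le (hΦ : IsQuantumChannel Φ) (hρ : ρ.PosDef)
    (hρ_tr : ρ.trace = 1) (A : Matrix n n ℂ) (t : ℝ) {ε : ℝ} (hε : 0 < ε) (hε2 : ε < 1 / 2) :
    bkmLowerBound Φ ρ A t ε ≤ bkmMetric ρ A - bkmMetric (Φ ρ) (Φ A) := by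
  set D := bkmMetric ρ A - bkmMetric (Φ ρ) (Φ A) with hD
  have hD0 : 0 ≤ D := sub_nonneg.2 (hΦ.bkmMetric_map_le hρ A)
  have hc : 0 < Real.pi / Real.cosh (Real.pi * t) := div_pos Real.pi_pos (Real.cosh_pos _)
  have hx := le_mul_rpow_of_forall_le hD0 (by positivity) hε hε2
    fun a ha ha1 => hΦ.recoveryError_bound hρ A t ha ha1
  have hx' := (mul_le_mul_of_nonneg_left (traceNorm_sub_rotatedPetz_le Φ hρ hρ_tr A t) hc.le).trans
    hx
  rw [← bkmConst] at hx'
  have hK : 0 < bkmConst Φ ρ A ε := by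
    unfold bkmConst
    positivity
  have h0 := traceNorm_nonneg (A - rotatedPetz Φ ρ t (Φ A))
  have he : 0 < 1 - 2 * ε := by linarith
  have hbase : Real.pi / Real.cosh (Real.pi * t) *
      (traceNorm (A - rotatedPetz Φ ρ t (Φ A)) / bkmConst Φ ρ A ε) ≤ D ^ ((1 - 2 * ε) / 4) := by
    rw [← mul_div_assoc, div_le_iff₀' hK]
    exact hx'
  calc bkmLowerBound Φ ρ A t ε ≤ (D ^ ((1 - 2 * ε) / 4)) ^ (4 / (1 - 2 * ε)) :=
        Real.rpow_le_rpow (by positivity) hbase (by positivity)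
    _ = D := by
        rw [← Real.rpow_mul hD0, show (1 - 2 * ε) / 4 * (4 / (1 - 2 * ε)) = 1 by field_simp,
          Real.rpow_one]

end Recovery
end QInfo

theorem corollary4p9 {n m : Type*} [Fintype n] [DecidableEq n] [Fintype m] [DecidableEq m]
    (Φ : Matrix n n ℂ →ₗ[ℂ] Matrix m m ℂ) (hΦ : QInfo.IsQuantumChannel Φ)
    (ρ : Matrix n n ℂ) (hρ : ρ.PosDef) (hρ_tr : ρ.trace = 1)
    (A : Matrix n n ℂ) (t : ℝ) :
    MeasureTheory.IntegrableOn (QInfo.bkmIntegrand ρ A) (Set.Ioi 0) ∧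
    MeasureTheory.IntegrableOn (QInfo.bkmIntegrand (Φ ρ) (Φ A)) (Set.Ioi 0) ∧
    BddAbove (QInfo.bkmLowerBound Φ ρ A t '' Set.Ioo 0 (1 / 2)) ∧
    QInfo.bkmMetric ρ A - QInfo.bkmMetric (Φ ρ) (Φ A) ≥
      sSup (QInfo.bkmLowerBound Φ ρ A t '' Set.Ioo 0 (1 / 2)) := by
  have hσ := hΦ.map_posSemidef hρ.posSemidef
  have hle : ∀ x ∈ QInfo.bkmLowerBound Φ ρ A t '' Set.Ioo 0 (1 / 2),
      x ≤ QInfo.bkmMetric ρ A - QInfo.bkmMetric (Φ ρ) (Φ A) := by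
    rintro _ ⟨ε, hε, rfl⟩
    exact hΦ.bkmLowerBound_le hρ hρ_tr A t hε.1 hε.2
  refine ⟨QInfo.integrableOn_bkmIntegrand hρ.posSemidef (QInfo.isSupported_of_posDef hρ A),
    QInfo.integrableOn_bkmIntegrand hσ (hΦ.isSupported_map hρ hσ.1 A), ⟨_, hle⟩, ?_⟩
  exact csSup_le ((Set.nonempty_Ioo.2 (by norm_num)).image _) hle
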